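/- **Setting.** A secondary base station (SBS) with $M$ antennas can serve secondary users (SUs) $1,\dots,K$ and coexists with $L\ge 1$ primary transmitter–receiver pairs, $\mathcal T=\{1,\dots,L\}$. Let $\mathcal S\subseteq\{1,\dots,K\}$ be the selected set, $|\mathcal S|\ge 2$, and $k\in\mathcal S$. The channel from primary transmitter $l$ to SU-$j$ is $h_{lj}\sim\mathcal{CN}(0,\beta_{lj})$, and all $h_{lj}$ are independent. The channel between the SBS and SU-$j$ is $\mathbf h_j\sim\mathcal{CN}(0,\beta_j\mathbf I_M)$; its estimate is $\hat{\mathbf h}_j=\mathbf h_j+\boldsymbol\delta_j$ with error $\boldsymbol\delta_j\sim\mathcal{CN}(0,\sigma_\delta^2\mathbf I_M)$, so that $\hat{\mathbf h}_j\sim\mathcal{CN}(0,(\beta_j+\sigma_\delta^2)\mathbf I_M)$. Let $\mathbf G_{\mathcal S}\in\mathbb C^{M\times(|\mathcal S|+L)}$ have as columns the estimated channels of the SUs in $\mathcal S$ and of the $L$ primary receivers; it is assumed to have full column rank. The zero-forcing vector $\mathbf v_j$ is the normalized column of $\mathbf G_{\mathcal S}(\mathbf G_{\mathcal S}^H\mathbf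 G_{\mathcal S})^{-1}$ that belongs to SU-$j$. All of $\beta_j,\beta_{lj}$, the noise power $\sigma_w^2$, the error variance $\sigma_\delta^2$, the primary power $P_p$ and the required rates $R^0_j$ are positive, and the margin $\varepsilon_2$ is nonnegative. With $I_j=\sum_{l\in\mathcal T}P_p|h_{lj}|^2$, power allocation and achieved rate are $$P_j=\frac{(2^{R_j^0}-1)(\sigma_w^2+I_j+\varepsilon_2)}{|\hat{\mathbf h}_j^H\mathbf v_j|^2},\qquad R_k^{\mathcal S}=\log_2\Bigl(1+\frac{P_k|\mathbf h_k^H\mathbf v_k|^2}{\sigma_w^2+I_k+Z_k}\Bigr),\qquad Z_k=\sum_{j\in\mathcal S\setminus\{k\}}P_j|\mathbf h_k^H\mathbf v_j|^2 .$$ **Approximations.** The rate is considered under the following approximations. 1. For each $j\in\mathcal S$ the gains $|\hat{\mathbf h}_j^H\mathbf v_j|^2$ and $|\mathbf h_j^H\mathbf v_j|^2$ are replaced by the averages of $|\mathbf x^H\mathbf v_j(\mathbf x)|^2$ for $\mathbf x\sim\mathcal{CN}(0,(\beta_j+\sigma_\delta^2)\mathbf I_M)$ and $\mathbf x\sim\mathcal{CN}(0,\beta_j\mathbf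 I_M)$, respectively. Here $\mathbf v_j(\mathbf x)$ is the zero-forcing vector of SU-$j$ when its column in $\mathbf G_{\mathcal S}$ is $\mathbf x$ and the other columns are fixed. 2. In $P_j$, $j\neq k$, the variable $\sigma_w^2+I_j+\varepsilon_2$ is replaced by a Gamma variable with the same mean and variance. 3. $Z_k$ is replaced by a Gamma variable, independent of $(h_{lk})_{l\in\mathcal T}$, whose mean and variance are the sums over $j\in\mathcal S\setminus\{k\}$ of the means and variances of $P_j|\boldsymbol\delta^H\mathbf v_j|^2$. Here $P_j$ is as approximated in 1 and 2, and $\boldsymbol\delta\sim\mathcal{CN}(0,\sigma_\delta^2\mathbf I_M)$ is independent of $P_j$ and $\mathbf v_j$. **Theorem 2.** Under these approximations, for every realization of the channel estimates for which $\mathbf G_{\mathcal S}$ has full column rank and every $y>0$, $$\Pr(R_k^{\mathcal S}\ge y)=\frac1{2\pi}\int_{-\infty}^{\zeta_y}\int_{-\infty}^{\infty}\Bigl[(1-\mathrm i\,\theta_k^z t)^{-\kappa_k^z}\prod_{l\in\mathcal T}(1-\mathrm i\,\theta_{lk}^z t)^{-1}\Bigr]e^{-\mathrm i wt}\,dt\,dw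 ,$$ where the power is the principal one and $$C_y=\frac{\beta_k}{\beta_k+\sigma_\delta^2}\cdot\frac{2^{R_k^0}-1}{2^y-1},\qquad \zeta_y=C_y(\sigma_w^2+\varepsilon_2)-\sigma_w^2,\qquad \theta^z_{lk}=(1-C_y)P_p\beta_{lk},$$ $$\kappa_k^z=\frac{\Bigl(\sum_{j\in\mathcal S\setminus\{k\}}\gamma_j\theta_j^p\,\Gamma(\kappa_j^p+1)/\Gamma(\kappa_j^p)\Bigr)^2}{\sum_{j\in\mathcal S\setminus\{k\}}\bigl(\gamma_j\theta_j^p/\Gamma(\kappa_j^p)\bigr)^2\bigl(2\Gamma(\kappa_j^p+2)\Gamma(\kappa_j^p)-\Gamma(\kappa_j^p+1)^2\bigr)},\qquad \theta_k^z=\frac{\sigma_\delta^2}{\kappa_k^z}\sum_{j\in\mathcal S\setminus\{k\}}\gamma_j\theta_j^p\,\frac{\Gamma(\kappa_j^p+1)}{\Gamma(\kappa_j^p)},$$ $$\kappa_j^p=\frac{\bigl(\sigma_w^2+\varepsilon_2+\sum_{l}P_p\beta_{lj}\bigr)^2}{\sum_{l}(P_p\beta_{lj})^2},\qquad \theta_j^p=\frac{\sum_{l}(P_p\beta_{lj})^2}{\sigma_w^2+\varepsilon_2+\sum_{l}P_p\beta_{lj}},\qquad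 \gamma_j=\frac{2^{R_j^0}-1}{(\beta_j+\sigma_\delta^2)(M-|\mathcal S|-L+1)} .$$ If $C_y\ne1$, the inner integral converges absolutely for every $w$. In general it is the limit of $\int_{-T}^{T}$ as $T\to\infty$, which exists for every $w\neq0$. As a function of $w$ it is integrable on $(-\infty,\zeta_y]$. -/

import Mathlib

open MeasureTheory ProbabilityTheory Filter Topology

noncomputable section

namespace UnderlayCRN

/-! ### Gaussian and Gamma laws -/

/-- The circularly symmetric complex Gaussian law `CN(0, b)`: independent real and imaginary parts,
each centred with variance `b / 2`. -/
def complexGaussian (b : ℝ) : Measure ℂ :=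
  ((gaussianReal 0 (b / 2).toNNReal).prod (gaussianReal 0 (b / 2).toNNReal)).map
    (fun p => (⟨p.1, p.2⟩ : ℂ))

/-- The isotropic complex Gaussian law `CN(0, b I)` on `ℂ ^ M`. -/
def isoGaussian (M : ℕ) (b : ℝ) : Measure (EuclideanSpace ℂ (Fin M)) :=
  (Measure.pi (fun _ : Fin M => complexGaussian b)).map (WithLp.toLp 2)

/-- The Gamma law with shape `κ` and *scale* `θ` (mathlib's `gammaMeasure` takes shape and rate). -/
def gammaLaw (κ θ : ℝ) : Measure ℝ := gammaMeasure κ θ⁻¹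

/-- The Gamma law with mean `m` and variance `v`: the solution of `κ θ = m`, `κ θ ^ 2 = v` is
`κ = m ^ 2 / v`, `θ = v / m`. -/
def gammaOfMoments (m v : ℝ) : Measure ℝ := gammaLaw (m ^ 2 / v) (v / m)

/-! ### Zero-forcing beamforming -/

/-- The matrix whose columns are the given vectors of `ℂ ^ M`. -/
def columnMatrix {M : ℕ} {ι : Type*} (g : ι → EuclideanSpace ℂ (Fin M)) :
    Matrix (Fin M) ι ℂ :=
  Matrix.of (fun m i => g i m)

/-- The unit-norm zero-forcing vector of index `i` for the channel matrix `G` with columns `g`: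
the normalized `i`-th column of `G (Gᴴ G)⁻¹`. -/
def zfVector {M : ℕ} {ι : Type*} [Fintype ι] [DecidableEq ι]
    (g : ι → EuclideanSpace ℂ (Fin M)) (i : ι) : EuclideanSpace ℂ (Fin M) :=
  let G := columnMatrix g
  let u : EuclideanSpace ℂ (Fin M) :=
    WithLp.toLp 2 (fun m => (G * (G.conjTranspose * G)⁻¹) m i)
  ((‖u‖⁻¹ : ℝ) : ℂ) • u

/-! ### The network -/

/-- Parameters of an underlay network with `M` antennas at the secondary base station (SBS),
`K` secondary users (SUs) and `L` primary transmitter-receiver pairs. -/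
structure Network (M K L : ℕ) where
  /-- slow fading coefficient of the channel between the SBS and SU-`k` -/
  β : Fin K → ℝ
  /-- slow fading coefficient of the channel between primary transmitter `l` and SU-`k` -/
  βr : Fin L → Fin K → ℝ
  /-- noise power `σ_w²` -/
  σw2 : ℝ
  /-- variance `σ_δ²` of the channel estimation errors of the SUs -/
  σδ2 : ℝ
  /-- transmit power `P_p` of the primary transmitters -/
  Pp : ℝ
  /-- margin parameter `ε₂` -/
  ε2 : ℝ
  /-- required rates `R⁰_k` -/
  R0 : Fin K → ℝ
  β_pos : ∀ k, 0 < β k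
  βr_pos : ∀ l k, 0 < βr l k
  σw2_pos : 0 < σw2
  σδ2_pos : 0 < σδ2
  Pp_pos : 0 < Pp
  ε2_nonneg : 0 ≤ ε2
  R0_pos : ∀ k, 0 < R0 k

variable {M K L : ℕ}

namespace Network

/-- The reverse interference `I_k = ∑_l P_p |h_{lk}|²`, as a function of the channels
`h_{lk}`, `l = 1, …, L`. -/
def reverseInterference (N : Network M K L) (h : Fin L → ℂ) : ℝ :=
  ∑ l, N.Pp * ‖h l‖ ^ 2

/-- The power allocated to SU-`k`,
`P_k = (2 ^ R⁰_k - 1) (σ_w² + I_k + ε₂) / |ĥ_kᴴ v_k|²`, as a function of the estimated gain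
`gHat = |ĥ_kᴴ v_k|²` and of `x = σ_w² + I_k + ε₂`. -/
def power (N : Network M K L) (k : Fin K) (gHat x : ℝ) : ℝ :=
  ((2 : ℝ) ^ N.R0 k - 1) * x / gHat

/-- The achieved rate `log₂ (1 + P_k |h_kᴴ v_k|² / (σ_w² + I_k + Z))` with the power `P_k` above,
as a function of the true gain `g = |h_kᴴ v_k|²`, the estimated gain `gHat = |ĥ_kᴴ v_k|²`, the
reverse interference `I` and the inter-SU interference `Z = ∑_{j ≠ k} P_j |h_kᴴ v_j|²`. -/
def rate (N : Network M K L) (k : Fin K) (g gHat I Z : ℝ) : ℝ :=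
  Real.logb 2 (1 + N.power k gHat (N.σw2 + I + N.ε2) * g / (N.σw2 + I + Z))

end Network

/-- The columns of `G_S`: the estimated channels `ĥ_j` of the SUs in `S`, followed by the estimated
channels of the primary receivers. -/
def channels (S : Finset (Fin K)) (hHat : Fin K → EuclideanSpace ℂ (Fin M))
    (hHat0 : Fin L → EuclideanSpace ℂ (Fin M)) : S ⊕ Fin L → EuclideanSpace ℂ (Fin M) :=
  Sum.elim (fun j => hHat j) hHat0

/-- The average over `x ∼ CN(0, b I)` of the beamforming gain `|xᴴ v_k|²`, where `v_k` is the
zero-forcing vector of SU-`k` when `x` is its estimated channel and the estimated channels of the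
other SUs in `S` and of the primary receivers are the given ones. -/
def averageGain (S : Finset (Fin K)) (hHat : Fin K → EuclideanSpace ℂ (Fin M))
    (hHat0 : Fin L → EuclideanSpace ℂ (Fin M)) (k : S) (b : ℝ) : ℝ :=
  ∫ x, ‖inner ℂ x
      (zfVector (Function.update (channels S hHat hHat0) (Sum.inl k) x) (Sum.inl k))‖ ^ 2
    ∂(isoGaussian M b)

namespace Network

/-! ### The approximate model: mean-value and moment-matching approximations -/

/-- Law of `σ_w² + I_j + ε₂`, for independent channels `h_{lj} ∼ CN(0, β_{lj})`. -/
def noiseInterferenceLaw (N : Network M K L) (j : Fin K) : Measure ℝ :=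
  (Measure.pi (fun l => complexGaussian (N.βr l j))).map
    (fun h => N.σw2 + N.reverseInterference h + N.ε2)

/-- Model of the power `P_j`: the estimated gain is replaced by its average (the estimated channel
has law `CN(0, (β_j + σ_δ²) I)`) and `σ_w² + I_j + ε₂` by the Gamma variable with the same mean and
variance. -/
def powerLaw (N : Network M K L) (S : Finset (Fin K))
    (hHat : Fin K → EuclideanSpace ℂ (Fin M)) (hHat0 : Fin L → EuclideanSpace ℂ (Fin M))
    (j : S) : Measure ℝ :=
  (gammaOfMoments (∫ x, x ∂(N.noiseInterferenceLaw j))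
      (variance id (N.noiseInterferenceLaw j))).map
    (fun x => N.power j (averageGain S hHat hHat0 j (N.β j + N.σδ2)) x)

/-- Model of the interference `P_j |δᴴ v_j|²` caused by the stream of SU-`j` at another SU:
`P_j` follows its model, and the estimation error `δ ∼ CN(0, σ_δ² I)` of the other SU is
independent of `P_j` and of the zero-forcing vector `v_j`. -/
def interferenceLaw (N : Network M K L) (S : Finset (Fin K))
    (hHat : Fin K → EuclideanSpace ℂ (Fin M)) (hHat0 : Fin L → EuclideanSpace ℂ (Fin M))
    (j : S) : Measure ℝ :=
  ((N.powerLaw S hHat hHat0 j).prod (isoGaussian M N.σδ2)).map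
    (fun q => q.1 * ‖inner ℂ q.2 (zfVector (channels S hHat hHat0) (Sum.inl j))‖ ^ 2)

/-- Model of the total inter-SU interference at SU-`k`: the Gamma law whose mean and variance are
the sums, over the other SUs `j` in `S`, of the means and variances of `P_j |δᴴ v_j|²`. -/
def interSULaw (N : Network M K L) (S : Finset (Fin K))
    (hHat : Fin K → EuclideanSpace ℂ (Fin M)) (hHat0 : Fin L → EuclideanSpace ℂ (Fin M))
    (k : S) : Measure ℝ :=
  gammaOfMoments
    (∑ j ∈ Finset.univ.erase k, ∫ x, x ∂(N.interferenceLaw S hHat hHat0 j))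
    (∑ j ∈ Finset.univ.erase k, variance id (N.interferenceLaw S hHat hHat0 j))

/-- The achieved rate at SU-`k` under the mean-value approximation of the two gains
`|h_kᴴ v_k|²` and `|ĥ_kᴴ v_k|²`, as a function of the reverse interference `I` and of the
inter-SU interference `Z`. -/
def modelRate (N : Network M K L) (S : Finset (Fin K))
    (hHat : Fin K → EuclideanSpace ℂ (Fin M)) (hHat0 : Fin L → EuclideanSpace ℂ (Fin M))
    (k : S) (I Z : ℝ) : ℝ :=
  N.rate k (averageGain S hHat hHat0 k (N.β k))
    (averageGain S hHat hHat0 k (N.β k + N.σδ2)) I Z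

/-! ### The explicit parameters of the formula -/

/-- `κ^p_j` -/
def kappaP (N : Network M K L) (j : Fin K) : ℝ :=
  (N.σw2 + N.ε2 + ∑ l, N.Pp * N.βr l j) ^ 2 / ∑ l, (N.Pp * N.βr l j) ^ 2

/-- `θ^p_j` -/
def thetaP (N : Network M K L) (j : Fin K) : ℝ :=
  (∑ l, (N.Pp * N.βr l j) ^ 2) / (N.σw2 + N.ε2 + ∑ l, N.Pp * N.βr l j)

/-- `γ^S_j` -/
def gammaS (N : Network M K L) (S : Finset (Fin K)) (j : Fin K) : ℝ :=
  ((2 : ℝ) ^ N.R0 j - 1) / ((N.β j + N.σδ2) * ((M : ℝ) - (S.card : ℝ) - (L : ℝ) + 1))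

/-- `κ^z_k` -/
def kappaZ (N : Network M K L) (S : Finset (Fin K)) (k : Fin K) : ℝ :=
  (∑ j ∈ S.erase k, N.gammaS S j * N.thetaP j *
      Real.Gamma (N.kappaP j + 1) / Real.Gamma (N.kappaP j)) ^ 2 /
    ∑ j ∈ S.erase k, (N.gammaS S j * N.thetaP j / Real.Gamma (N.kappaP j)) ^ 2 *
      (2 * Real.Gamma (N.kappaP j + 2) * Real.Gamma (N.kappaP j) -
        Real.Gamma (N.kappaP j + 1) ^ 2)

/-- `θ^z_k` -/
def thetaZ (N : Network M K L) (S : Finset (Fin K)) (k : Fin K) : ℝ :=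
  N.σδ2 / N.kappaZ S k *
    ∑ j ∈ S.erase k, N.gammaS S j * N.thetaP j *
      (Real.Gamma (N.kappaP j + 1) / Real.Gamma (N.kappaP j))

/-- `C_y` -/
def C (N : Network M K L) (k : Fin K) (y : ℝ) : ℝ :=
  N.β k / (N.β k + N.σδ2) * (((2 : ℝ) ^ N.R0 k - 1) / ((2 : ℝ) ^ y - 1))

/-- `ζ_y` -/
def zeta (N : Network M K L) (k : Fin K) (y : ℝ) : ℝ :=
  N.C k y * (N.σw2 + N.ε2) - N.σw2

/-- `θ^z_{lk}` -/
def thetaLK (N : Network M K L) (l : Fin L) (k : Fin K) (y : ℝ) : ℝ :=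
  (1 - N.C k y) * N.Pp * N.βr l k

/-- The integrand `(1 - i θ^z_k t) ^ (-κ^z_k) ∏_l (1 - i θ^z_{lk} t)⁻¹ exp (-i w t)`. -/
def integrand (N : Network M K L) (S : Finset (Fin K)) (k : Fin K) (y w t : ℝ) : ℂ :=
  (1 - (N.thetaZ S k : ℂ) * Complex.I * (t : ℂ)) ^ (-(N.kappaZ S k : ℂ)) *
    (∏ l, (1 - (N.thetaLK l k y : ℂ) * Complex.I * (t : ℂ))⁻¹) *
    Complex.exp (-(Complex.I * (w : ℂ) * (t : ℂ)))

end Network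

end UnderlayCRN

end

/-! With the channel estimates fixed, the averaged gains are constants. The gain `|xᴴ v(x)|²` of a
zero-forcing vector is the squared norm of the projection of `x` to the orthogonal complement of the
other `|S| + L - 1` columns, so its average over `CN(0, b I)` is `b (M - |S| - L + 1)`
(`averageGain_eq`). The ratio of true to estimated gain is therefore `β_k / (β_k + σ_δ²)`, and
clearing the logarithm and the denominator turns the rate event into the linear inequality `Z + (1 -
C_y) I ≤ ζ_y` (`le_modelRate_iff`).

The laws are explicit. Each `|δᴴ v_j|²` is exponential because `v_j` is a unit vector, and it is
independent of the Gamma-distributed model of `P_j`; the moments thus multiply, and matching them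
gives `Z` the shape `κ^z_k` and the scale `θ^z_k` (`interSULaw_eq`). The interference `I` is a sum
of independent exponentials. By independence the bracket in the integrand is the characteristic
function of `Z + (1 - C_y) I`.

If `C_y ≠ 1`, at least one exponential factor adds a decay `|t|⁻¹` to the decay `|t|^(-κ)` of the
Gamma factor. The characteristic function is then integrable, and Fourier inversion yields the
density (`measureReal_eq_integral_of_integrable_charFun`). If `C_y = 1`, only the Gamma factor is
left, which is not integrable for small shapes. Integration by parts trades shape `κ` for `κ + 1`
and gives the density as an improper integral at every `w ≠ 0`
(`tendsto_intervalIntegral_cpow_mul_exp`). -/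

namespace UnderlayCRN

/-! ### Moments and characteristic function of the Gamma law -/

section Gamma

variable {κ r : ℝ}

theorem measurable_gammaPDF (κ r : ℝ) : Measurable (gammaPDF κ r) :=
  (measurable_gammaPDFReal κ r).ennreal_ofReal

theorem toReal_gammaPDF (hκ : 0 < κ) (hr : 0 < r) (x : ℝ) :
    (gammaPDF κ r x).toReal = gammaPDFReal κ r x :=
  ENNReal.toReal_ofReal (gammaPDFReal_nonneg hκ hr x)

theorem integral_gammaMeasure {E : Type*} [NormedAddCommGroup E] [NormedSpace ℝ E]
    (hκ : 0 < κ) (hr : 0 < r) (f : ℝ → E) :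
    ∫ x, f x ∂(gammaMeasure κ r) = ∫ x, gammaPDFReal κ r x • f x := by
  rw [gammaMeasure, integral_withDensity_eq_integral_toReal_smul
    (measurable_gammaPDF κ r) (ae_of_all _ fun _ => ENNReal.ofReal_lt_top)]
  simp_rw [toReal_gammaPDF hκ hr]

theorem integrable_gammaMeasure_iff {E : Type*} [NormedAddCommGroup E] [NormedSpace ℝ E]
    (hκ : 0 < κ) (hr : 0 < r) (f : ℝ → E) :
    Integrable f (gammaMeasure κ r) ↔ Integrable (fun x => gammaPDFReal κ r x • f x) := by
  rw [gammaMeasure, integrable_withDensity_iff_integrable_smul'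
    (measurable_gammaPDF κ r) (ae_of_all _ fun _ => ENNReal.ofReal_lt_top)]
  simp_rw [toReal_gammaPDF hκ hr]

theorem integrable_gammaPDFReal (hκ : 0 < κ) (hr : 0 < r) : Integrable (gammaPDFReal κ r) := by
  have := isProbabilityMeasure_gammaMeasure hκ hr
  simpa using (integrable_gammaMeasure_iff hκ hr (fun _ => (1 : ℝ))).1 (integrable_const 1)

theorem integral_gammaPDFReal (hκ : 0 < κ) (hr : 0 < r) : ∫ x, gammaPDFReal κ r x = 1 := by
  have := isProbabilityMeasure_gammaMeasure hκ hr
  simpa using (integral_gammaMeasure hκ hr (fun _ => (1 : ℝ))).symm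

/-- A power of `x` is absorbed by raising the shape, so every moment reduces to the total mass of
another Gamma density. The null point `0` is set aside, where `rpow` does not split. -/
theorem gammaPDFReal_mul_pow (hκ : 0 < κ) (hr : 0 < r) (n : ℕ) {x : ℝ} (hx : x ≠ 0) :
    gammaPDFReal κ r x * x ^ n =
      Real.Gamma (κ + n) / Real.Gamma κ / r ^ n * gammaPDFReal (κ + n) r x := by
  rcases lt_or_gt_of_ne hx with h | h
  · simp [gammaPDFReal, not_le.2 h]
  · have h1 := (Real.Gamma_pos_of_pos hκ).ne'
    have h2 : Real.Gamma (κ + n) ≠ 0 := (Real.Gamma_pos_of_pos (by positivity)).ne'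
    rw [gammaPDFReal, gammaPDFReal, if_pos h.le, if_pos h.le,
      show κ + n - 1 = (κ - 1) + n by ring, Real.rpow_add_natCast h.ne',
      Real.rpow_add_natCast hr.ne']
    field_simp

theorem integrable_pow_gammaMeasure (hκ : 0 < κ) (hr : 0 < r) (n : ℕ) :
    Integrable (fun x : ℝ => x ^ n) (gammaMeasure κ r) := by
  rw [integrable_gammaMeasure_iff hκ hr]
  refine ((integrable_gammaPDFReal (κ := κ + n) (by positivity) hr).const_mul
    (Real.Gamma (κ + n) / Real.Gamma κ / r ^ n)).congr ?_
  filter_upwards [Measure.ae_ne volume 0] with x hx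
  rw [smul_eq_mul, gammaPDFReal_mul_pow hκ hr n hx]

theorem integral_pow_gammaMeasure (hκ : 0 < κ) (hr : 0 < r) (n : ℕ) :
    ∫ x, x ^ n ∂(gammaMeasure κ r) = Real.Gamma (κ + n) / Real.Gamma κ / r ^ n := by
  have h : ∫ x, gammaPDFReal κ r x • x ^ n =
      ∫ x, Real.Gamma (κ + n) / Real.Gamma κ / r ^ n * gammaPDFReal (κ + n) r x := by
    refine integral_congr_ae ?_
    filter_upwards [Measure.ae_ne volume 0] with x hx
    rw [smul_eq_mul, gammaPDFReal_mul_pow hκ hr n hx]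
  rw [integral_gammaMeasure hκ hr, h, integral_const_mul,
    integral_gammaPDFReal (by positivity) hr, mul_one]

/-- Exponential tilting only lowers the rate to `r - t`; the real moment generating function is then
the normalizing ratio. -/
theorem gammaPDFReal_mul_exp (hr : 0 < r) {t : ℝ} (ht : t < r) (x : ℝ) :
    gammaPDFReal κ r x * Real.exp (t * x) =
      (r / (r - t)) ^ κ * gammaPDFReal κ (r - t) x := by
  have h0 : 0 < r - t := sub_pos.2 ht
  unfold gammaPDFReal
  split_ifs with hx
  · rw [Real.div_rpow hr.le h0.le, show -((r - t) * x) = -(r * x) + t * x by ring, Real.exp_add]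
    have := (Real.rpow_pos_of_pos h0 κ).ne'
    field_simp
  · simp

theorem integrable_exp_gammaMeasure (hκ : 0 < κ) (hr : 0 < r) {t : ℝ} (ht : t < r) :
    Integrable (fun x => Real.exp (t * x)) (gammaMeasure κ r) := by
  rw [integrable_gammaMeasure_iff hκ hr]
  simp_rw [smul_eq_mul, gammaPDFReal_mul_exp hr ht]
  exact (integrable_gammaPDFReal hκ (sub_pos.2 ht)).const_mul _

theorem mgf_gammaMeasure (hκ : 0 < κ) (hr : 0 < r) {t : ℝ} (ht : t < r) :
    mgf id (gammaMeasure κ r) t = (r / (r - t)) ^ κ := by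
  rw [mgf, integral_gammaMeasure hκ hr]
  simp_rw [smul_eq_mul, id, gammaPDFReal_mul_exp hr ht]
  rw [integral_const_mul, integral_gammaPDFReal hκ (sub_pos.2 ht), mul_one]

/-- Both the complex moment generating function and `(1 - z / r) ^ (-κ)` are analytic on the
half-plane `re z < r`, where the base has positive real part and the principal power is harmless.
They agree at real points accumulating at `0`, hence on the whole half-plane, in particular at `z =
i t`. -/
theorem charFun_gammaMeasure (hκ : 0 < κ) (hr : 0 < r) (t : ℝ) :
    charFun (gammaMeasure κ r) t =
      (1 - (r⁻¹ : ℂ) * Complex.I * (t : ℂ)) ^ (-(κ : ℂ)) := by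
  set U : Set ℂ := {z | z.re < r}
  have hsub : U ⊆ {z | z.re ∈ interior (integrableExpSet id (gammaMeasure κ r))} := fun z hz =>
    interior_maximal (fun s (hs : s < r) => integrable_exp_gammaMeasure hκ hr hs) isOpen_Iio hz
  have hA : AnalyticOnNhd ℂ (complexMGF id (gammaMeasure κ r)) U :=
    analyticOnNhd_complexMGF.mono hsub
  have hre : ∀ z ∈ U, 0 < (1 - (r⁻¹ : ℂ) * z).re := by
    intro z hz
    have h1 : (r⁻¹ : ℝ) * z.re < 1 := by
      rw [inv_mul_lt_iff₀ hr, mul_one]; exact hz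
    rw [← Complex.ofReal_inv, Complex.sub_re, Complex.re_ofReal_mul, Complex.one_re]
    linarith
  have hopen : IsOpen U := isOpen_Iio.preimage Complex.continuous_re
  have hB : AnalyticOnNhd ℂ (fun z : ℂ => (1 - (r⁻¹ : ℂ) * z) ^ (-(κ : ℂ))) U := by
    refine DifferentiableOn.analyticOnNhd (fun z hz => ?_) hopen
    refine DifferentiableAt.differentiableWithinAt ?_
    exact ((differentiableAt_const _).sub (differentiableAt_id.const_mul _)).cpow_const
      (Or.inl (hre z hz))
  have hfreq : ∃ᶠ z in 𝓝[≠] (0 : ℂ), complexMGF id (gammaMeasure κ r) z =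
      (1 - (r⁻¹ : ℂ) * z) ^ (-(κ : ℂ)) := by
    have htend : Tendsto (fun s : ℝ => (s : ℂ)) (𝓝[≠] 0) (𝓝[≠] 0) := by
      refine tendsto_nhdsWithin_iff.2 ⟨?_, ?_⟩
      · exact (Complex.continuous_ofReal.tendsto' 0 0 Complex.ofReal_zero).mono_left
          nhdsWithin_le_nhds
      · filter_upwards [self_mem_nhdsWithin] with s hs
        simpa using hs
    refine htend.frequently (Eventually.frequently ?_)
    filter_upwards [nhdsWithin_le_nhds (Iio_mem_nhds hr)] with s hs
    have hs : s < r := hs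
    have h0 : 0 < r - s := sub_pos.2 hs
    rw [complexMGF_ofReal, mgf_gammaMeasure hκ hr hs]
    have h1 : (1 - (r⁻¹ : ℂ) * s) = (((r - s) / r : ℝ) : ℂ) := by
      have : (r : ℂ) ≠ 0 := Complex.ofReal_ne_zero.2 hr.ne'
      push_cast
      field_simp
    rw [h1, ← Complex.ofReal_neg, ← Complex.ofReal_cpow (by positivity),
      Real.rpow_neg (by positivity), ← Real.inv_rpow (by positivity), inv_div]
  have hEq := hA.eqOn_of_preconnected_of_frequently_eq hB
    ((convex_halfSpace_re_lt r).isPreconnected) (by simpa [U] using hr) hfreq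
  rw [← complexMGF_id_mul_I, hEq (show (t : ℂ) * Complex.I ∈ U by simpa [U] using hr)]
  simp only
  congr 2
  ring

end Gamma

/-! ### Complex Gaussian laws -/

section ComplexGaussian

theorem measurable_complex_mk : Measurable (fun p : ℝ × ℝ => (⟨p.1, p.2⟩ : ℂ)) :=
  Complex.measurableEquivRealProd.symm.measurable

instance (b : ℝ) : IsProbabilityMeasure (complexGaussian b) :=
  Measure.isProbabilityMeasure_map measurable_complex_mk.aemeasurable

instance (M : ℕ) (b : ℝ) : IsProbabilityMeasure (isoGaussian M b) :=
  Measure.isProbabilityMeasure_map (WithLp.measurable_toLp 2 _).aemeasurable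

theorem charFun_complexGaussian {b : ℝ} (hb : 0 < b) (t : ℂ) :
    charFun (complexGaussian b) t = Complex.exp (-(b * ‖t‖ ^ 2 / 4 : ℝ)) := by
  have h : ∀ p : ℝ × ℝ, Complex.exp ((inner ℝ (⟨p.1, p.2⟩ : ℂ) t : ℝ) * Complex.I) =
      Complex.exp (t.re * p.1 * Complex.I) * Complex.exp (t.im * p.2 * Complex.I) := by
    intro p
    rw [← Complex.exp_add, Complex.inner]
    simp only [Complex.mul_re, Complex.conj_re, Complex.conj_im]
    push_cast
    ring_nf
  rw [charFun_apply, complexGaussian, integral_map measurable_complex_mk.aemeasurable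
    (by fun_prop)]
  simp_rw [h]
  rw [integral_prod_mul (fun x : ℝ => Complex.exp (t.re * x * Complex.I))
    (fun y : ℝ => Complex.exp (t.im * y * Complex.I)), ← charFun_apply_real,
    ← charFun_apply_real, charFun_gaussianReal, charFun_gaussianReal, ← Complex.exp_add,
    Complex.sq_norm, Complex.normSq_apply, Real.coe_toNNReal _ (by positivity)]
  congr 1
  push_cast
  ring

theorem charFun_isoGaussian {M : ℕ} {b : ℝ} (hb : 0 < b) (s : EuclideanSpace ℂ (Fin M)) :
    charFun (isoGaussian M b) s = Complex.exp (-(b * ‖s‖ ^ 2 / 4 : ℝ)) := by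
  rw [isoGaussian, charFun_pi]
  simp_rw [charFun_complexGaussian hb]
  rw [← Complex.exp_sum, EuclideanSpace.norm_sq_eq, Finset.mul_sum, Finset.sum_div]
  push_cast
  rw [Finset.sum_neg_distrib]

/-- Testing `⟪x, v⟫` against `t` is testing `x` against `conj t • v`, a vector of norm `|t|`; the
characteristic function of the isotropic law sees nothing but this norm. -/
theorem map_inner_isoGaussian {M : ℕ} {b : ℝ} (hb : 0 < b) {v : EuclideanSpace ℂ (Fin M)}
    (hv : ‖v‖ = 1) :
    (isoGaussian M b).map (fun x => inner ℂ x v) = complexGaussian b := by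
  have : IsProbabilityMeasure ((isoGaussian M b).map (fun x => inner ℂ x v)) :=
    Measure.isProbabilityMeasure_map (by fun_prop)
  refine Measure.ext_of_charFun (funext fun t => ?_)
  have h : ∀ x : EuclideanSpace ℂ (Fin M), inner ℝ (inner ℂ x v) t =
      inner ℝ x ((starRingEnd ℂ t) • v) := by
    intro x
    rw [PiLp.inner_apply, PiLp.inner_apply, Complex.inner, map_sum, Finset.mul_sum,
      Complex.re_sum]
    refine Finset.sum_congr rfl fun i _ => ?_
    rw [Complex.inner]
    simp
    ring
  rw [charFun_complexGaussian hb, charFun_apply, integral_map (by fun_prop) (by fun_prop)]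
  simp_rw [h]
  rw [← charFun_apply, charFun_isoGaussian hb, norm_smul, hv]
  simp

/-- The real and imaginary parts contribute equal factors to the characteristic function of `|z|²`.
Stating the square of one factor removes the complex square root of the Gaussian integral, and with
it any choice of branch. -/
theorem integral_exp_sq_gaussianReal {b : ℝ} (hb : 0 < b) (t : ℝ) :
    (∫ x : ℝ, Complex.exp (t * x ^ 2 * Complex.I) ∂(gaussianReal 0 (b / 2).toNNReal)) ^ 2 =
      (1 - (b : ℂ) * Complex.I * t)⁻¹ := by
  have hv : (b / 2).toNNReal ≠ 0 := by simpa using hb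
  have hb' : (b : ℂ) ≠ 0 := Complex.ofReal_ne_zero.2 hb.ne'
  have hπ : (Real.pi : ℂ) ≠ 0 := Complex.ofReal_ne_zero.2 Real.pi_ne_zero
  have h : ∀ x : ℝ, gaussianPDFReal 0 (b / 2).toNNReal x •
      Complex.exp (t * x ^ 2 * Complex.I) =
      ((√(Real.pi * b))⁻¹ : ℝ) * Complex.exp (-((b⁻¹ : ℝ) - t * Complex.I) * x ^ 2) := by
    intro x
    rw [gaussianPDFReal, Real.coe_toNNReal _ (by positivity), Complex.real_smul,
      show 2 * Real.pi * (b / 2) = Real.pi * b by ring, Complex.ofReal_mul, mul_assoc,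
      Complex.ofReal_exp, ← Complex.exp_add]
    congr 2
    push_cast
    field_simp
    ring
  have hre : 0 < (((b⁻¹ : ℝ) : ℂ) - t * Complex.I).re := by simpa using hb
  have hne : (1 - (b : ℂ) * Complex.I * t) ≠ 0 := by
    intro h0
    simpa using congrArg Complex.re h0
  rw [integral_gaussianReal_eq_integral_smul hv]
  simp_rw [h]
  rw [integral_const_mul, integral_gaussian_complex hre, mul_pow, ← Complex.cpow_nat_mul,
    ← Complex.ofReal_pow, inv_pow, Real.sq_sqrt (by positivity)]
  have h1 : ((b⁻¹ : ℝ) : ℂ) - t * Complex.I = (1 - (b : ℂ) * Complex.I * t) / b := by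
    push_cast
    field_simp
  rw [h1]
  push_cast
  norm_num
  field_simp

theorem map_norm_sq_complexGaussian {b : ℝ} (hb : 0 < b) :
    (complexGaussian b).map (fun z => ‖z‖ ^ 2) = gammaMeasure 1 b⁻¹ := by
  have := isProbabilityMeasure_gammaMeasure one_pos (inv_pos.2 hb)
  have : IsProbabilityMeasure ((complexGaussian b).map (fun z => ‖z‖ ^ 2)) :=
    Measure.isProbabilityMeasure_map (by fun_prop)
  refine Measure.ext_of_charFun (funext fun t => ?_)
  have h : ∀ p : ℝ × ℝ, Complex.exp (t * (‖(⟨p.1, p.2⟩ : ℂ)‖ ^ 2 : ℝ) * Complex.I) =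
      Complex.exp (t * p.1 ^ 2 * Complex.I) * Complex.exp (t * p.2 ^ 2 * Complex.I) := by
    intro p
    rw [← Complex.exp_add, Complex.sq_norm, Complex.normSq_apply]
    push_cast
    ring_nf
  rw [charFun_gammaMeasure one_pos (inv_pos.2 hb), charFun_apply_real,
    integral_map (by fun_prop) (by fun_prop), complexGaussian,
    integral_map measurable_complex_mk.aemeasurable (by fun_prop)]
  simp_rw [h]
  rw [integral_prod_mul (fun x : ℝ => Complex.exp (t * x ^ 2 * Complex.I))
    (fun x : ℝ => Complex.exp (t * x ^ 2 * Complex.I)), ← sq, integral_exp_sq_gaussianReal hb]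
  push_cast
  rw [inv_inv, Complex.cpow_neg_one]

theorem map_norm_inner_sq_isoGaussian {M : ℕ} {b : ℝ} (hb : 0 < b)
    {v : EuclideanSpace ℂ (Fin M)} (hv : ‖v‖ = 1) :
    (isoGaussian M b).map (fun x => ‖inner ℂ x v‖ ^ 2) = gammaMeasure 1 b⁻¹ := by
  rw [← map_norm_sq_complexGaussian hb, ← map_inner_isoGaussian hb hv,
    Measure.map_map (by fun_prop) (by fun_prop)]
  rfl

end ComplexGaussian

/-! ### Zero-forcing vectors as normalized projections -/

section ZeroForcing

theorem columnMatrix_conjTranspose_mul_self {M : ℕ} {ι : Type*}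
    (g : ι → EuclideanSpace ℂ (Fin M)) :
    (columnMatrix g).conjTranspose * columnMatrix g = Matrix.gram ℂ g := by
  ext i j
  rw [Matrix.mul_apply, Matrix.gram_apply, PiLp.inner_apply]
  refine Finset.sum_congr rfl fun m _ => ?_
  simp [columnMatrix, mul_comm]

variable {M : ℕ} {ι : Type*} [Fintype ι] [DecidableEq ι]

/-- The column of `G (Gᴴ G)⁻¹` of index `i`. -/
noncomputable def pinvColumn (g : ι → EuclideanSpace ℂ (Fin M)) (i : ι) :
    EuclideanSpace ℂ (Fin M) :=
  ∑ j, (Matrix.gram ℂ g)⁻¹ j i • g j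

theorem zfVector_eq (g : ι → EuclideanSpace ℂ (Fin M)) (i : ι) :
    zfVector g i = ((‖pinvColumn g i‖⁻¹ : ℝ) : ℂ) • pinvColumn g i := by
  have h : (WithLp.toLp 2 (fun m => (columnMatrix g *
      ((columnMatrix g).conjTranspose * columnMatrix g)⁻¹) m i) :
        EuclideanSpace ℂ (Fin M)) = pinvColumn g i := by
    ext m
    rw [columnMatrix_conjTranspose_mul_self, pinvColumn]
    simp [Matrix.mul_apply, columnMatrix, mul_comm]
  rw [zfVector, h]

/-- The zero-forcing property is the identity `Gram * Gram⁻¹ = 1` read entrywise. -/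
theorem inner_pinvColumn {g : ι → EuclideanSpace ℂ (Fin M)} (hg : LinearIndependent ℂ g)
    (i l : ι) : inner ℂ (g l) (pinvColumn g i) = if l = i then 1 else 0 := by
  have hu : IsUnit (Matrix.gram ℂ g).det :=
    (Matrix.det_gram_ne_zero_iff_linearIndependent.2 hg).isUnit
  have h := congrFun (congrFun (Matrix.mul_nonsing_inv _ hu) l) i
  rw [Matrix.one_apply, Matrix.mul_apply] at h
  rw [← h, pinvColumn, inner_sum]
  refine Finset.sum_congr rfl fun j _ => ?_
  rw [inner_smul_right, Matrix.gram_apply, mul_comm]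

/-- The inverse of a singular matrix is `0` by convention. This lets the gain formula hold for every
value of a column, including those in the span of the others, with no exceptional set. -/
theorem pinvColumn_eq_zero {g : ι → EuclideanSpace ℂ (Fin M)} (hg : ¬ LinearIndependent ℂ g)
    (i : ι) : pinvColumn g i = 0 := by
  have hu : ¬ IsUnit (Matrix.gram ℂ g).det := by
    rw [isUnit_iff_ne_zero]
    exact fun h => hg (Matrix.det_gram_ne_zero_iff_linearIndependent.1 h)
  simp [pinvColumn, Matrix.nonsing_inv_apply_not_isUnit _ hu]

theorem norm_zfVector {g : ι → EuclideanSpace ℂ (Fin M)} (hg : LinearIndependent ℂ g) (i : ι) :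
    ‖zfVector g i‖ = 1 := by
  have h : pinvColumn g i ≠ 0 := by
    intro h0
    simpa [h0] using inner_pinvColumn hg i i
  rw [zfVector_eq, norm_smul, Complex.norm_real, norm_inv, norm_norm,
    inv_mul_cancel₀ (norm_ne_zero_iff.2 h)]

/-- The span of the columns other than the one of index `i`. -/
def otherSpan (g : ι → EuclideanSpace ℂ (Fin M)) (i : ι) :
    Submodule ℂ (EuclideanSpace ℂ (Fin M)) :=
  Submodule.span ℂ (g '' {i}ᶜ)

/-- The beamforming gain of a zero-forcing vector is the squared norm of the projection of the
channel to the orthogonal complement of the other channels. -/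
theorem norm_inner_zfVector_sq {g : ι → EuclideanSpace ℂ (Fin M)} {i : ι}
    (hg : LinearIndepOn ℂ g {i}ᶜ) :
    ‖inner ℂ (g i) (zfVector g i)‖ ^ 2 = ‖(otherSpan g i)ᗮ.starProjection (g i)‖ ^ 2 := by
  by_cases h : LinearIndependent ℂ g
  · set W := otherSpan g i
    set u := pinvColumn g i with hu
    set q := Wᗮ.starProjection (g i) with hq
    have huW : u ∈ Wᗮ := by
      rw [Submodule.mem_orthogonal]
      intro w hw
      refine Submodule.span_induction (p := fun w _ => inner ℂ w u = 0) ?_ ?_ ?_ ?_ hw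
      · rintro _ ⟨j, hj, rfl⟩
        rw [hu, inner_pinvColumn h, if_neg (by simpa using hj)]
      · simp
      · intro x y _ _ hx hy
        rw [inner_add_left, hx, hy, add_zero]
      · intro a x _ hx
        rw [inner_smul_left, hx, mul_zero]
    have hPu : Wᗮ.starProjection u = u := Submodule.starProjection_eq_self_iff.2 huW
    -- The projection to `Wᗮ` fixes `u` and annihilates every column but `g i`. So `u` is a multiple
    -- of `q`, and `⟪q, u⟫ = 1` then forces `‖u‖ = ‖q‖⁻¹`.
    have hu_eq : u = (Matrix.gram ℂ g)⁻¹ i i • q := by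
      rw [← hPu, hu, pinvColumn, map_sum, Finset.sum_eq_single i]
      · rw [map_smul]
      · intro j _ hj
        rw [map_smul, Submodule.starProjection_orthogonal_apply_eq_zero
          (K := W) (Submodule.subset_span (Set.mem_image_of_mem g hj)), smul_zero]
      · simp
    have h1 : inner ℂ (g i) u = 1 := by rw [hu, inner_pinvColumn h, if_pos rfl]
    have h2 : inner ℂ q u = 1 := by
      rw [hq, Submodule.inner_starProjection_left_eq_right, hPu, h1]
    set c := (Matrix.gram ℂ g)⁻¹ i i
    have hq0 : ‖q‖ ≠ 0 := by
      intro h0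
      rw [norm_eq_zero] at h0
      simp [h0] at h2
    have hc : ‖c‖ * ‖q‖ ^ 2 = 1 := by
      rw [hu_eq, inner_smul_right, inner_self_eq_norm_sq_to_K] at h2
      simpa using congrArg norm h2
    have hun : ‖u‖ = ‖q‖⁻¹ := by
      rw [hu_eq, norm_smul, ← mul_eq_one_iff_eq_inv₀ hq0, ← hc]
      ring
    rw [zfVector_eq, inner_smul_right, ← hu, h1, hun]
    simp
  -- Degenerate case: the column lies in the span of the others, so its projection vanishes, and the
  -- zero-forcing vector takes its default value `0`.
  · have hmem : g i ∈ otherSpan g i := by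
      by_contra hx
      refine h (linearIndepOn_univ_iff.1 ?_)
      have := hg.insert hx
      rwa [show insert i ({i}ᶜ : Set ι) = Set.univ by ext; simp [em]] at this
    rw [Submodule.starProjection_orthogonal_apply_eq_zero hmem, zfVector_eq,
      pinvColumn_eq_zero h]
    simp

theorem finrank_otherSpan {g : ι → EuclideanSpace ℂ (Fin M)} {i : ι}
    (hg : LinearIndepOn ℂ g {i}ᶜ) :
    Module.finrank ℂ (otherSpan g i) + 1 = Fintype.card ι := by
  have h := finrank_span_eq_card hg
  rw [show Set.range (fun x : ({i}ᶜ : Set ι) => g x) = g '' {i}ᶜ by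
    rw [← Set.image_eq_range]] at h
  rw [otherSpan, h, Fintype.card_compl_set]
  have : 0 < Fintype.card ι := Fintype.card_pos_iff.2 ⟨i⟩
  simp
  omega

end ZeroForcing

/-! ### Average gains -/

section Average

variable {M : ℕ}

theorem integrable_norm_inner_sq_isoGaussian {b : ℝ} (hb : 0 < b)
    {v : EuclideanSpace ℂ (Fin M)} (hv : ‖v‖ = 1) :
    Integrable (fun x => ‖inner ℂ x v‖ ^ 2) (isoGaussian M b) := by
  have h := integrable_pow_gammaMeasure one_pos (inv_pos.2 hb) 1
  simp only [pow_one] at h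
  rw [← map_norm_inner_sq_isoGaussian hb hv] at h
  exact h.comp_measurable (by fun_prop)

theorem integral_norm_inner_sq_isoGaussian {b : ℝ} (hb : 0 < b)
    {v : EuclideanSpace ℂ (Fin M)} (hv : ‖v‖ = 1) :
    ∫ x, ‖inner ℂ x v‖ ^ 2 ∂(isoGaussian M b) = b := by
  have h := integral_pow_gammaMeasure one_pos (inv_pos.2 hb) 1
  simp only [pow_one] at h
  rw [← map_norm_inner_sq_isoGaussian hb hv, integral_map (by fun_prop) (by fun_prop)] at h
  rw [h, Nat.cast_one, Real.Gamma_add_one one_ne_zero]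
  simp

/-- In an orthonormal basis of `W` the squared norm is a sum of `finrank W` coordinates, each of
mean `b`. -/
theorem integral_norm_starProjection_sq_isoGaussian {b : ℝ} (hb : 0 < b)
    (W : Submodule ℂ (EuclideanSpace ℂ (Fin M))) :
    ∫ x, ‖W.starProjection x‖ ^ 2 ∂(isoGaussian M b) = Module.finrank ℂ W * b := by
  set e := stdOrthonormalBasis ℂ W
  have h : ∀ x, ‖W.starProjection x‖ ^ 2 =
      ∑ i, ‖inner ℂ x (e i : EuclideanSpace ℂ (Fin M))‖ ^ 2 := by
    intro x
    have h1 := e.sum_sq_norm_inner_left (W.orthogonalProjectionOnto x)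
    rw [show ‖W.starProjection x‖ = ‖W.orthogonalProjectionOnto x‖ from rfl, ← h1]
    refine Finset.sum_congr rfl fun i _ => ?_
    rw [Submodule.coe_inner]
    change ‖inner ℂ (W.starProjection x) _‖ ^ 2 = _
    rw [Submodule.inner_starProjection_left_eq_right,
      Submodule.starProjection_eq_self_iff.2 (e i).2]
  have hn : ∀ i, ‖(e i : EuclideanSpace ℂ (Fin M))‖ = 1 := fun i => e.orthonormal.1 i
  simp_rw [h]
  rw [integral_finsetSum _ fun i _ => integrable_norm_inner_sq_isoGaussian hb (hn i)]
  simp_rw [integral_norm_inner_sq_isoGaussian hb (hn _)]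
  simp

/-- Changing the column of index `k` leaves the span of the other columns unchanged. The gain is
thus the squared norm of a projection to one fixed subspace, of dimension `M - (|S| + L - 1)`. -/
theorem averageGain_eq {K L : ℕ} {S : Finset (Fin K)} {hHat : Fin K → EuclideanSpace ℂ (Fin M)}
    {hHat0 : Fin L → EuclideanSpace ℂ (Fin M)}
    (hG : LinearIndependent ℂ (channels S hHat hHat0)) (k : S) {b : ℝ} (hb : 0 < b) :
    averageGain S hHat hHat0 k b = b * ((M : ℝ) - (S.card : ℝ) - (L : ℝ) + 1) := by
  set i : S ⊕ Fin L := Sum.inl k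
  set g := channels S hHat hHat0
  have himg : ∀ x, Set.EqOn (Function.update g i x) g {i}ᶜ := fun x j hj =>
    Function.update_of_ne hj _ _
  have hind : LinearIndepOn ℂ g {i}ᶜ := hG.linearIndepOn _
  have hspan : ∀ x, otherSpan (Function.update g i x) i = otherSpan g i := fun x => by
    rw [otherSpan, otherSpan, (himg x).image_eq]
  have h : ∀ x, ‖inner ℂ x (zfVector (Function.update g i x) i)‖ ^ 2 =
      ‖(otherSpan g i)ᗮ.starProjection x‖ ^ 2 := by
    intro x
    have h1 := norm_inner_zfVector_sq (g := Function.update g i x) (i := i)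
      (hind.congr (himg x).symm)
    rw [Function.update_self] at h1
    rw [h1, hspan]
  change ∫ x, ‖inner ℂ x (zfVector (Function.update g i x) i)‖ ^ 2 ∂_ = _
  simp_rw [h]
  rw [integral_norm_starProjection_sq_isoGaussian hb]
  have h2 := finrank_otherSpan hind
  have h3 := (otherSpan g i).finrank_add_finrank_orthogonal
  rw [finrank_euclideanSpace_fin] at h3
  rw [Fintype.card_sum, Fintype.card_coe, Fintype.card_fin] at h2
  have h2' : (Module.finrank ℂ (otherSpan g i) : ℝ) + 1 = S.card + L := by exact_mod_cast h2
  have h3' : (Module.finrank ℂ (otherSpan g i) : ℝ) + Module.finrank ℂ (otherSpan g i)ᗮ = M := by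
    exact_mod_cast h3
  rw [mul_comm]
  congr 1
  linarith

theorem card_add_le {K L : ℕ} {S : Finset (Fin K)} {hHat : Fin K → EuclideanSpace ℂ (Fin M)}
    {hHat0 : Fin L → EuclideanSpace ℂ (Fin M)}
    (hG : LinearIndependent ℂ (channels S hHat hHat0)) : S.card + L ≤ M := by
  have := hG.fintype_card_le_finrank
  rwa [finrank_euclideanSpace_fin, Fintype.card_sum, Fintype.card_coe, Fintype.card_fin] at this

end Average

/-! ### Moments in the approximate model -/

section GammaLaw

variable {κ θ : ℝ}

theorem isProbabilityMeasure_gammaLaw (hκ : 0 < κ) (hθ : 0 < θ) :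
    IsProbabilityMeasure (gammaLaw κ θ) :=
  isProbabilityMeasure_gammaMeasure hκ (inv_pos.2 hθ)

theorem integral_id_gammaLaw (hκ : 0 < κ) (hθ : 0 < θ) :
    ∫ x, x ∂(gammaLaw κ θ) = κ * θ := by
  have h := integral_pow_gammaMeasure hκ (inv_pos.2 hθ) 1
  simp only [pow_one] at h
  have h0 := (Real.Gamma_pos_of_pos hκ).ne'
  rw [gammaLaw, h, Nat.cast_one, Real.Gamma_add_one hκ.ne']
  field_simp

theorem integral_sq_gammaLaw (hκ : 0 < κ) (hθ : 0 < θ) :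
    ∫ x, x ^ 2 ∂(gammaLaw κ θ) = κ * (κ + 1) * θ ^ 2 := by
  have h0 := (Real.Gamma_pos_of_pos hκ).ne'
  rw [gammaLaw, integral_pow_gammaMeasure hκ (inv_pos.2 hθ) 2, Nat.cast_ofNat,
    show κ + 2 = κ + 1 + 1 by ring, Real.Gamma_add_one (by positivity),
    Real.Gamma_add_one hκ.ne']
  field_simp

theorem integrable_sq_gammaLaw (hκ : 0 < κ) (hθ : 0 < θ) :
    Integrable (fun x => x ^ 2) (gammaLaw κ θ) :=
  integrable_pow_gammaMeasure hκ (inv_pos.2 hθ) 2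

theorem memLp_id_gammaLaw (hκ : 0 < κ) (hθ : 0 < θ) : MemLp id 2 (gammaLaw κ θ) :=
  (memLp_two_iff_integrable_sq aestronglyMeasurable_id).2 (integrable_sq_gammaLaw hκ hθ)

theorem variance_id_gammaLaw (hκ : 0 < κ) (hθ : 0 < θ) :
    variance id (gammaLaw κ θ) = κ * θ ^ 2 := by
  have := isProbabilityMeasure_gammaLaw hκ hθ
  rw [variance_eq_sub (memLp_id_gammaLaw hκ hθ)]
  have h1 := integral_id_gammaLaw hκ hθ
  have h2 := integral_sq_gammaLaw hκ hθ
  simp only [Pi.pow_apply, id_eq]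
  rw [h1, h2]
  ring

theorem charFun_gammaLaw (hκ : 0 < κ) (hθ : 0 < θ) (t : ℝ) :
    charFun (gammaLaw κ θ) t = (1 - (θ : ℂ) * Complex.I * (t : ℂ)) ^ (-(κ : ℂ)) := by
  rw [gammaLaw, charFun_gammaMeasure hκ (inv_pos.2 hθ), Complex.ofReal_inv, inv_inv]

end GammaLaw

theorem map_norm_sq_complexGaussian_eq_gammaLaw {b : ℝ} (hb : 0 < b) :
    (complexGaussian b).map (fun z => ‖z‖ ^ 2) = gammaLaw 1 b :=
  map_norm_sq_complexGaussian hb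

theorem map_norm_inner_sq_isoGaussian_eq_gammaLaw {M : ℕ} {b : ℝ} (hb : 0 < b)
    {v : EuclideanSpace ℂ (Fin M)} (hv : ‖v‖ = 1) :
    (isoGaussian M b).map (fun x => ‖inner ℂ x v‖ ^ 2) = gammaLaw 1 b :=
  map_norm_inner_sq_isoGaussian hb hv

theorem memLp_norm_sq_complexGaussian {b : ℝ} (hb : 0 < b) :
    MemLp (fun z : ℂ => ‖z‖ ^ 2) 2 (complexGaussian b) := by
  have h := memLp_id_gammaLaw one_pos hb
  rw [← map_norm_sq_complexGaussian_eq_gammaLaw hb] at h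
  exact (memLp_map_measure_iff aestronglyMeasurable_id (by fun_prop)).1 h

theorem integral_norm_sq_complexGaussian {b : ℝ} (hb : 0 < b) :
    ∫ z, ‖z‖ ^ 2 ∂(complexGaussian b) = b := by
  have h := integral_id_gammaLaw one_pos hb
  rwa [← map_norm_sq_complexGaussian_eq_gammaLaw hb,
    integral_map (by fun_prop) (by fun_prop), one_mul] at h

theorem variance_norm_sq_complexGaussian {b : ℝ} (hb : 0 < b) :
    variance (fun z : ℂ => ‖z‖ ^ 2) (complexGaussian b) = b ^ 2 := by
  have h := variance_id_gammaLaw one_pos hb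
  rwa [← map_norm_sq_complexGaussian_eq_gammaLaw hb,
    variance_id_map (by fun_prop), one_mul] at h

namespace Network

variable {M K L : ℕ} (N : Network M K L)

/-! ### Mean and variance of the noise plus reverse interference. -/

section NoiseInterference

theorem measurable_reverseInterference : Measurable N.reverseInterference :=
  Finset.measurable_fun_sum _ fun l _ =>
    (((measurable_pi_apply l).norm).pow_const 2).const_mul N.Pp

theorem measurable_noiseInterference :
    Measurable (fun h : Fin L → ℂ => N.σw2 + N.reverseInterference h + N.ε2) :=
  (measurable_const.add N.measurable_reverseInterference).add measurable_const

theorem integral_noiseInterferenceLaw (j : Fin K) :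
    ∫ x, x ∂(N.noiseInterferenceLaw j) = N.σw2 + N.ε2 + ∑ l, N.Pp * N.βr l j := by
  have hint : ∀ l, Integrable (fun h : Fin L → ℂ => N.Pp * ‖h l‖ ^ 2)
      (Measure.pi fun l => complexGaussian (N.βr l j)) := fun l =>
    (integrable_comp_eval (i := l) (μ := fun l => complexGaussian (N.βr l j))
      ((memLp_norm_sq_complexGaussian (N.βr_pos l j)).integrable one_le_two)).const_mul _
  have hval : ∀ l, ∫ h : Fin L → ℂ, N.Pp * ‖h l‖ ^ 2
      ∂(Measure.pi fun l => complexGaussian (N.βr l j)) = N.Pp * N.βr l j := by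
    intro l
    rw [integral_const_mul, integral_comp_eval (i := l)
      (μ := fun l => complexGaussian (N.βr l j)) (f := fun z : ℂ => ‖z‖ ^ 2) (by fun_prop),
      integral_norm_sq_complexGaussian (N.βr_pos l j)]
  have hsum := integrable_finsetSum Finset.univ fun l _ => hint l
  rw [noiseInterferenceLaw, integral_map N.measurable_noiseInterference.aemeasurable
    (by fun_prop)]
  unfold reverseInterference
  have hsum' : Integrable (fun h : Fin L → ℂ => N.σw2 + ∑ l, N.Pp * ‖h l‖ ^ 2)
      (Measure.pi fun l => complexGaussian (N.βr l j)) := (integrable_const _).add hsum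
  rw [integral_add hsum' (integrable_const _), integral_add (integrable_const _) hsum,
    integral_finsetSum _ fun l _ => hint l]
  simp_rw [hval]
  simp
  ring

theorem variance_noiseInterferenceLaw (j : Fin K) :
    variance id (N.noiseInterferenceLaw j) = ∑ l, (N.Pp * N.βr l j) ^ 2 := by
  have hf : (fun h : Fin L → ℂ => N.σw2 + N.reverseInterference h + N.ε2) =
      fun h => (∑ l, fun h : Fin L → ℂ => N.Pp * ‖h l‖ ^ 2) h + (N.σw2 + N.ε2) := by
    funext h
    rw [reverseInterference, Finset.sum_apply]
    ring
  unfold noiseInterferenceLaw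
  have hm : Measurable (∑ l, fun h : Fin L → ℂ => N.Pp * ‖h l‖ ^ 2) := by fun_prop
  rw [variance_id_map N.measurable_noiseInterference.aemeasurable, hf,
    variance_add_const hm.aestronglyMeasurable,
    variance_sum_pi (μ := fun l => complexGaussian (N.βr l j))
      (X := fun _ z => N.Pp * ‖z‖ ^ 2)
      fun l => (memLp_norm_sq_complexGaussian (N.βr_pos l j)).const_mul _]
  refine Finset.sum_congr rfl fun l _ => ?_
  rw [variance_const_mul, variance_norm_sq_complexGaussian (N.βr_pos l j), mul_pow]

variable {N}

theorem sum_sq_pos (hL : 0 < L) (j : Fin K) : 0 < ∑ l, (N.Pp * N.βr l j) ^ 2 :=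
  Finset.sum_pos (fun l _ => by have := N.Pp_pos; have := N.βr_pos l j; positivity)
    ⟨⟨0, hL⟩, Finset.mem_univ _⟩

theorem mean_pos (j : Fin K) : 0 < N.σw2 + N.ε2 + ∑ l, N.Pp * N.βr l j := by
  have h := Finset.sum_nonneg fun l (_ : l ∈ Finset.univ) =>
    (mul_pos N.Pp_pos (N.βr_pos l j)).le
  linarith [N.σw2_pos, N.ε2_nonneg]

theorem kappaP_pos (hL : 0 < L) (j : Fin K) : 0 < N.kappaP j :=
  div_pos (pow_pos (mean_pos j) 2) (sum_sq_pos hL j)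

theorem thetaP_pos (hL : 0 < L) (j : Fin K) : 0 < N.thetaP j :=
  div_pos (sum_sq_pos hL j) (mean_pos j)

theorem gammaOfMoments_noiseInterferenceLaw (j : Fin K) :
    gammaOfMoments (∫ x, x ∂(N.noiseInterferenceLaw j))
      (variance id (N.noiseInterferenceLaw j)) = gammaLaw (N.kappaP j) (N.thetaP j) := by
  rw [integral_noiseInterferenceLaw, variance_noiseInterferenceLaw, gammaOfMoments, kappaP, thetaP]

end NoiseInterference

/-! ### Moments of the power and of the inter-SU interference. -/

section Interference

variable {N} {S : Finset (Fin K)} {hHat : Fin K → EuclideanSpace ℂ (Fin M)}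
  {hHat0 : Fin L → EuclideanSpace ℂ (Fin M)}

theorem dim_pos (hG : LinearIndependent ℂ (channels S hHat hHat0)) :
    0 < (M : ℝ) - (S.card : ℝ) - (L : ℝ) + 1 := by
  have h : ((S.card + L : ℕ) : ℝ) ≤ M := Nat.cast_le.2 (card_add_le hG)
  push_cast at h
  linarith

theorem two_rpow_sub_one_pos {x : ℝ} (hx : 0 < x) : 0 < (2 : ℝ) ^ x - 1 :=
  sub_pos.2 (Real.one_lt_rpow one_lt_two hx)

theorem gammaS_pos (hG : LinearIndependent ℂ (channels S hHat hHat0)) (j : Fin K) :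
    0 < N.gammaS S j :=
  div_pos (two_rpow_sub_one_pos (N.R0_pos j))
    (mul_pos (add_pos (N.β_pos j) N.σδ2_pos) (dim_pos hG))

theorem powerLaw_eq (hG : LinearIndependent ℂ (channels S hHat hHat0)) (j : S) :
    N.powerLaw S hHat hHat0 j =
      (gammaLaw (N.kappaP j) (N.thetaP j)).map (fun x => N.gammaS S j * x) := by
  rw [powerLaw, gammaOfMoments_noiseInterferenceLaw,
    averageGain_eq hG j (add_pos (N.β_pos j) N.σδ2_pos)]
  congr 1
  funext x
  rw [power, gammaS]
  ring

theorem integral_powerLaw (hL : 0 < L) (hG : LinearIndependent ℂ (channels S hHat hHat0)) (j : S) :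
    ∫ x, x ∂(N.powerLaw S hHat hHat0 j) = N.gammaS S j * (N.kappaP j * N.thetaP j) := by
  rw [powerLaw_eq hG, integral_map (by fun_prop) (by fun_prop), integral_const_mul,
    integral_id_gammaLaw (kappaP_pos hL _) (thetaP_pos hL _)]

theorem integral_sq_powerLaw (hL : 0 < L) (hG : LinearIndependent ℂ (channels S hHat hHat0))
    (j : S) :
    ∫ x, x ^ 2 ∂(N.powerLaw S hHat hHat0 j) =
      N.gammaS S j ^ 2 * (N.kappaP j * (N.kappaP j + 1) * N.thetaP j ^ 2) := by
  rw [powerLaw_eq hG, integral_map (by fun_prop) (by fun_prop)]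
  simp_rw [mul_pow]
  rw [integral_const_mul, integral_sq_gammaLaw (kappaP_pos hL _) (thetaP_pos hL _)]

theorem isProbabilityMeasure_powerLaw (hL : 0 < L)
    (hG : LinearIndependent ℂ (channels S hHat hHat0)) (j : S) :
    IsProbabilityMeasure (N.powerLaw S hHat hHat0 j) := by
  have := isProbabilityMeasure_gammaLaw (N.kappaP_pos hL j) (N.thetaP_pos hL j)
  rw [powerLaw_eq hG]
  exact Measure.isProbabilityMeasure_map (by fun_prop)

theorem integrable_sq_powerLaw (hL : 0 < L)
    (hG : LinearIndependent ℂ (channels S hHat hHat0)) (j : S) :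
    Integrable (fun x => x ^ 2) (N.powerLaw S hHat hHat0 j) := by
  rw [powerLaw_eq hG, integrable_map_measure (by fun_prop) (by fun_prop)]
  simp only [Function.comp_def, mul_pow]
  exact (integrable_sq_gammaLaw (kappaP_pos hL _) (thetaP_pos hL _)).const_mul _

theorem integral_interferenceLaw (hL : 0 < L)
    (hG : LinearIndependent ℂ (channels S hHat hHat0)) (j : S) :
    ∫ x, x ∂(N.interferenceLaw S hHat hHat0 j) =
      N.σδ2 * (N.gammaS S j * N.thetaP j * N.kappaP j) := by
  have := N.isProbabilityMeasure_powerLaw hL hG j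
  rw [interferenceLaw, integral_map (by fun_prop) (by fun_prop),
    integral_prod_mul (fun x : ℝ => x)
      (fun δ => ‖inner ℂ δ (zfVector (channels S hHat hHat0) (Sum.inl j))‖ ^ 2),
    integral_powerLaw hL hG,
    integral_norm_inner_sq_isoGaussian N.σδ2_pos (norm_zfVector hG _)]
  ring

/-- By independence the second moment of the product is the product of the second moments. The
factor `2` is that of an exponential variable, whose second moment is twice its squared mean. -/
theorem variance_interferenceLaw (hL : 0 < L)
    (hG : LinearIndependent ℂ (channels S hHat hHat0)) (j : S) :
    variance id (N.interferenceLaw S hHat hHat0 j) =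
      N.σδ2 ^ 2 * ((N.gammaS S j * N.thetaP j) ^ 2 *
        (2 * N.kappaP j * (N.kappaP j + 1) - N.kappaP j ^ 2)) := by
  have := N.isProbabilityMeasure_powerLaw hL hG j
  set v := zfVector (channels S hHat hHat0) (Sum.inl j) with hv
  have hv1 : ‖v‖ = 1 := norm_zfVector hG _
  have h4 : Integrable (fun δ => (‖inner ℂ δ v‖ ^ 2) ^ 2) (isoGaussian M N.σδ2) := by
    have h := integrable_sq_gammaLaw one_pos N.σδ2_pos
    rw [← map_norm_inner_sq_isoGaussian_eq_gammaLaw N.σδ2_pos hv1] at h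
    exact h.comp_measurable (by fun_prop)
  have h4v : ∫ δ, (‖inner ℂ δ v‖ ^ 2) ^ 2 ∂(isoGaussian M N.σδ2) = 2 * N.σδ2 ^ 2 := by
    have h := integral_sq_gammaLaw one_pos N.σδ2_pos
    rw [← map_norm_inner_sq_isoGaussian_eq_gammaLaw N.σδ2_pos hv1,
      integral_map (by fun_prop) (by fun_prop)] at h
    rw [h]
    ring
  have hsq : Integrable (fun q : ℝ × EuclideanSpace ℂ (Fin M) =>
      (q.1 * ‖inner ℂ q.2 v‖ ^ 2) ^ 2)
      ((N.powerLaw S hHat hHat0 j).prod (isoGaussian M N.σδ2)) := by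
    simp_rw [mul_pow _ _ 2]
    exact (integrable_sq_powerLaw hL hG j).mul_prod h4
  have hmean := integral_interferenceLaw (N := N) hL hG j
  rw [interferenceLaw, integral_map (by fun_prop) (by fun_prop), ← hv] at hmean
  rw [interferenceLaw, variance_id_map (by fun_prop), ← hv,
    variance_eq_sub ((memLp_two_iff_integrable_sq (by fun_prop)).2 hsq), hmean]
  simp only [Pi.pow_apply, mul_pow _ _ 2]
  rw [integral_prod_mul (fun x : ℝ => x ^ 2) (fun δ => (‖inner ℂ δ v‖ ^ 2) ^ 2), h4v,
    integral_sq_powerLaw hL hG]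
  ring

/-- The Gamma quotients collapse through `Γ(x + 1) = x Γ(x)` to the polynomials in `κ^p_j` that the
moment computation produces. -/
theorem kappaZ_eq (hL : 0 < L) (S : Finset (Fin K)) (k : Fin K) :
    N.kappaZ S k = (∑ j ∈ S.erase k, N.gammaS S j * N.thetaP j * N.kappaP j) ^ 2 /
      ∑ j ∈ S.erase k, (N.gammaS S j * N.thetaP j) ^ 2 *
        (2 * N.kappaP j * (N.kappaP j + 1) - N.kappaP j ^ 2) := by
  rw [kappaZ]
  congr 1
  · congr 1
    refine Finset.sum_congr rfl fun j _ => ?_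
    have h0 := (Real.Gamma_pos_of_pos (N.kappaP_pos hL j)).ne'
    rw [Real.Gamma_add_one (N.kappaP_pos hL j).ne']
    field_simp
  · refine Finset.sum_congr rfl fun j _ => ?_
    have h0 := (Real.Gamma_pos_of_pos (N.kappaP_pos hL j)).ne'
    have h1 := N.kappaP_pos hL j
    rw [show N.kappaP j + 2 = N.kappaP j + 1 + 1 by ring,
      Real.Gamma_add_one (by positivity), Real.Gamma_add_one h1.ne']
    field_simp

theorem thetaZ_eq (hL : 0 < L) (S : Finset (Fin K)) (k : Fin K) :
    N.thetaZ S k = N.σδ2 / N.kappaZ S k *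
      ∑ j ∈ S.erase k, N.gammaS S j * N.thetaP j * N.kappaP j := by
  rw [thetaZ]
  congr 1
  refine Finset.sum_congr rfl fun j _ => ?_
  have h0 := (Real.Gamma_pos_of_pos (N.kappaP_pos hL j)).ne'
  rw [Real.Gamma_add_one (N.kappaP_pos hL j).ne']
  field_simp

theorem erase_nonempty (hS : 2 ≤ S.card) (k : S) : (S.erase k).Nonempty := by
  rw [← Finset.card_pos, Finset.card_erase_of_mem k.2]
  omega

theorem first_moment_sum_pos (hL : 0 < L) (hS : 2 ≤ S.card)
    (hG : LinearIndependent ℂ (channels S hHat hHat0)) (k : S) :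
    0 < ∑ j ∈ S.erase k, N.gammaS S j * N.thetaP j * N.kappaP j :=
  Finset.sum_pos (fun j _ => mul_pos (mul_pos (gammaS_pos hG j) (thetaP_pos hL j))
    (kappaP_pos hL j)) (erase_nonempty hS k)

theorem second_moment_sum_pos (hL : 0 < L) (hS : 2 ≤ S.card)
    (hG : LinearIndependent ℂ (channels S hHat hHat0)) (k : S) :
    0 < ∑ j ∈ S.erase k, (N.gammaS S j * N.thetaP j) ^ 2 *
        (2 * N.kappaP j * (N.kappaP j + 1) - N.kappaP j ^ 2) := by
  refine Finset.sum_pos (fun j _ => ?_) (erase_nonempty hS k)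
  have h1 := gammaS_pos (N := N) hG j
  have h2 := N.thetaP_pos hL j
  have h3 := N.kappaP_pos hL j
  have h4 : 0 < 2 * N.kappaP j * (N.kappaP j + 1) - N.kappaP j ^ 2 := by nlinarith
  positivity

theorem kappaZ_pos (hL : 0 < L) (hS : 2 ≤ S.card)
    (hG : LinearIndependent ℂ (channels S hHat hHat0)) (k : S) : 0 < N.kappaZ S k := by
  rw [kappaZ_eq hL]
  exact div_pos (pow_pos (first_moment_sum_pos hL hS hG k) 2) (second_moment_sum_pos hL hS hG k)

theorem thetaZ_pos (hL : 0 < L) (hS : 2 ≤ S.card)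
    (hG : LinearIndependent ℂ (channels S hHat hHat0)) (k : S) : 0 < N.thetaZ S k := by
  rw [thetaZ_eq hL]
  exact mul_pos (div_pos N.σδ2_pos (kappaZ_pos hL hS hG k)) (first_moment_sum_pos hL hS hG k)

theorem sum_univ_erase (k : S) (f : Fin K → ℝ) :
    ∑ j ∈ (Finset.univ : Finset S).erase k, f j = ∑ j ∈ S.erase k, f j := by
  have h1 := Finset.add_sum_erase Finset.univ (fun j : S => f j) (Finset.mem_univ k)
  have h2 := Finset.add_sum_erase S f k.2
  have h3 : ∑ j : S, f j = ∑ j ∈ S, f j := Finset.sum_coe_sort S f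
  linarith

/-- Write the total mean as `σ_δ² A` and the total variance as `σ_δ⁴ B`. Then shape and scale are
`A² / B` and `σ_δ² B / A`. Both sums are nonzero because `|S| ≥ 2` leaves at least one interfering
user. -/
theorem interSULaw_eq (hL : 0 < L) (hS : 2 ≤ S.card)
    (hG : LinearIndependent ℂ (channels S hHat hHat0)) (k : S) :
    N.interSULaw S hHat hHat0 k = gammaLaw (N.kappaZ S k) (N.thetaZ S k) := by
  rw [interSULaw, gammaOfMoments]
  simp_rw [integral_interferenceLaw hL hG, variance_interferenceLaw hL hG]
  rw [← Finset.mul_sum, ← Finset.mul_sum,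
    sum_univ_erase k (fun j => N.gammaS S j * N.thetaP j * N.kappaP j),
    sum_univ_erase k (fun j => (N.gammaS S j * N.thetaP j) ^ 2 *
        (2 * N.kappaP j * (N.kappaP j + 1) - N.kappaP j ^ 2)),
    thetaZ_eq hL, kappaZ_eq hL]
  have h1 := (first_moment_sum_pos (N := N) hL hS hG k).ne'
  have h2 := (second_moment_sum_pos (N := N) hL hS hG k).ne'
  have h3 := N.σδ2_pos.ne'
  congr 1 <;> field_simp

end Interference

end Network

/-! ### Fourier inversion -/

section Inversion

open scoped FourierTransform SchwartzMap ContDiff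

theorem integral_fourier_smul_eq_smul_fourier {f g : ℝ → ℂ} (hf : Integrable f)
    (hg : Integrable g) : ∫ x, 𝓕 f x • g x = ∫ x, f x • 𝓕 g x := by
  simpa using! VectorFourier.integral_fourierIntegral_smul_eq_flip (L := innerₗ ℝ)
    Real.continuous_fourierChar continuous_inner hf hg

theorem continuous_fourier_of_integrable {f : ℝ → ℂ} (hf : Integrable f) : Continuous (𝓕 f) :=
  VectorFourier.fourierIntegral_continuous Real.continuous_fourierChar
    (innerSL ℝ).continuous₂ hf

/-- Fourier inversion holds almost everywhere for integrable functions with integrable Fourier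
transform. -/
theorem fourierInv_fourier_ae_eq {f : ℝ → ℂ} (hf : Integrable f) (hf' : Integrable (𝓕 f)) :
    𝓕⁻ (𝓕 f) =ᵐ[volume] f := by
  have hneg : 𝓕⁻ (𝓕 f) = 𝓕 (fun x => 𝓕 f (-x)) := Real.fourierInv_eq_fourier_comp_neg _
  have hcont : Continuous (𝓕⁻ (𝓕 f)) := by
    rw [hneg]
    exact continuous_fourier_of_integrable hf'.comp_neg
  -- Smooth compactly supported test functions are Schwartz, so inversion is known for them; the
  -- multiplication formula, used twice, carries it over to `f` by duality.
  refine ae_eq_of_integral_contDiff_smul_eq hcont.locallyIntegrable hf.locallyIntegrable ?_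
  intro g hg hgc
  have hGc : HasCompactSupport (fun x => (g x : ℂ)) :=
    hgc.comp_left (g := fun r : ℝ => (r : ℂ)) Complex.ofReal_zero
  let G : 𝓢(ℝ, ℂ) := hGc.toSchwartzMap (Complex.ofRealCLM.contDiff.comp hg)
  have hGx : ∀ x, G x = (g x : ℂ) := fun _ => rfl
  have hFH : 𝓕 (𝓕⁻ (G : ℝ → ℂ)) = G := by
    rw [← SchwartzMap.fourierInv_coe, ← SchwartzMap.fourier_coe,
      FourierTransform.fourier_fourierInv_eq]
  have hH : Integrable (𝓕⁻ (G : ℝ → ℂ)) := by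
    rw [← SchwartzMap.fourierInv_coe]
    exact SchwartzMap.integrable _
  calc ∫ x, g x • 𝓕⁻ (𝓕 f) x = ∫ x, G x • 𝓕 (fun x => 𝓕 f (-x)) x := by
        simp [hGx, hneg]
    _ = ∫ x, 𝓕 (G : ℝ → ℂ) x • 𝓕 f (-x) :=
        (integral_fourier_smul_eq_smul_fourier G.integrable hf'.comp_neg).symm
    _ = ∫ x, 𝓕 (G : ℝ → ℂ) (-x) • 𝓕 f x := by
        rw [← integral_neg_eq_self]
        simp
    _ = ∫ x, 𝓕⁻ (G : ℝ → ℂ) x • 𝓕 f x := by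
        simp_rw [Real.fourierInv_eq_fourier_neg]
    _ = ∫ x, 𝓕 (𝓕⁻ (G : ℝ → ℂ)) x • f x :=
        (integral_fourier_smul_eq_smul_fourier hH hf).symm
    _ = ∫ x, g x • f x := by
        rw [hFH]
        simp [hGx]

variable {f φ : ℝ → ℂ}

/-- Passage between the kernel `exp (i t x)` of probability and the kernel `exp (-2 π i v x)` of
`𝓕`; the substitution `t = -2 π v` is the source of the factor `2 π` in the inversion formulas. -/
theorem fourier_eq_of_forall_integral
    (hφ : ∀ t : ℝ, φ t = ∫ x : ℝ, Complex.exp (t * x * Complex.I) * f x) (v : ℝ) :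
    𝓕 f v = φ (-(2 * Real.pi) * v) := by
  rw [Real.fourier_real_eq_integral_exp_smul, hφ]
  refine integral_congr_ae (ae_of_all _ fun x => ?_)
  simp only [smul_eq_mul]
  congr 2
  push_cast
  ring

theorem integrable_fourier_of_forall_integral
    (hφ : ∀ t : ℝ, φ t = ∫ x : ℝ, Complex.exp (t * x * Complex.I) * f x) (hφi : Integrable φ) :
    Integrable (𝓕 f) := by
  rw [funext (fourier_eq_of_forall_integral hφ)]
  exact hφi.comp_mul_left' (by simp [Real.pi_ne_zero])

theorem fourierInv_fourier_eq_integral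
    (hφ : ∀ t : ℝ, φ t = ∫ x : ℝ, Complex.exp (t * x * Complex.I) * f x) (w : ℝ) :
    ∫ t, φ t * Complex.exp (-(Complex.I * w * t)) = 2 * Real.pi * 𝓕⁻ (𝓕 f) w := by
  rw [Real.fourierInv_eq']
  have h : ∀ v : ℝ, Complex.exp ((2 * Real.pi * inner ℝ v w : ℝ) * Complex.I) • 𝓕 f v =
      (fun t : ℝ => φ t * Complex.exp (-(Complex.I * w * t))) (-(2 * Real.pi) * v) := by
    intro v
    simp only
    rw [fourier_eq_of_forall_integral hφ, smul_eq_mul, mul_comm]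
    congr 2
    simp
    ring
  simp_rw [h]
  rw [Measure.integral_comp_mul_left (fun t : ℝ => φ t * Complex.exp (-(Complex.I * w * t))),
    abs_inv, abs_neg, abs_of_pos Real.two_pi_pos, Complex.real_smul]
  have : (Real.pi : ℂ) ≠ 0 := Complex.ofReal_ne_zero.2 Real.pi_ne_zero
  push_cast
  field_simp

/-- Pointwise inversion serves the improper integral, where the value at a given `w` matters; the
almost everywhere form suffices once the result is integrated over `w`. -/
theorem integral_mul_exp_of_continuousAt (hf : Integrable f)
    (hφ : ∀ t : ℝ, φ t = ∫ x : ℝ, Complex.exp (t * x * Complex.I) * f x) (hφi : Integrable φ)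
    {w : ℝ} (hw : ContinuousAt f w) :
    ∫ t, φ t * Complex.exp (-(Complex.I * w * t)) = 2 * Real.pi * f w := by
  rw [fourierInv_fourier_eq_integral hφ,
    hf.fourierInv_fourier_eq (integrable_fourier_of_forall_integral hφ hφi) hw]

theorem integral_mul_exp_ae_eq (hf : Integrable f)
    (hφ : ∀ t : ℝ, φ t = ∫ x : ℝ, Complex.exp (t * x * Complex.I) * f x) (hφi : Integrable φ) :
    (fun w : ℝ => ∫ t, φ t * Complex.exp (-(Complex.I * w * t))) =ᵐ[volume]
      fun w => 2 * Real.pi * f w := by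
  filter_upwards [fourierInv_fourier_ae_eq hf (integrable_fourier_of_forall_integral hφ hφi)]
    with w hw
  rw [fourierInv_fourier_eq_integral hφ, hw]

/-- An absolutely continuous probability law with integrable characteristic function `φ` has the
density `(2 π)⁻¹ ∫ φ t exp (-i w t) dt`. -/
theorem measureReal_eq_integral_of_integrable_charFun {μ : Measure ℝ} [IsProbabilityMeasure μ]
    (hμ : μ ≪ volume) (hφ : Integrable (charFun μ)) :
    Integrable (fun w : ℝ => ∫ t, charFun μ t * Complex.exp (-(Complex.I * w * t))) ∧
      ∀ s, MeasurableSet s → (μ.real s : ℂ) = 1 / (2 * (Real.pi : ℂ)) *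
        ∫ w : ℝ in s, ∫ t, charFun μ t * Complex.exp (-(Complex.I * w * t)) := by
  set f : ℝ → ℝ := fun x => (μ.rnDeriv volume x).toReal with hf_def
  have hf : Integrable f := Measure.integrable_toReal_rnDeriv
  have hfC : Integrable (fun x => (f x : ℂ)) := hf.ofReal
  have hrep : ∀ t : ℝ, charFun μ t = ∫ x : ℝ, Complex.exp (t * x * Complex.I) * (f x : ℂ) := by
    intro t
    rw [charFun_apply_real, ← integral_rnDeriv_smul hμ]
    refine integral_congr_ae (ae_of_all _ fun x => ?_)
    simp only [Complex.real_smul]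
    rw [mul_comm]
  have hae := integral_mul_exp_ae_eq hfC hrep hφ
  refine ⟨(hfC.const_mul _).congr hae.symm, fun s _ => ?_⟩
  rw [integral_congr_ae (ae_restrict_of_ae hae), integral_const_mul, integral_complex_ofReal,
    hf_def, Measure.setIntegral_toReal_rnDeriv hμ]
  have : (Real.pi : ℂ) ≠ 0 := Complex.ofReal_ne_zero.2 Real.pi_ne_zero
  field_simp

end Inversion

/-! ### The characteristic function of the Gamma law and its improper Fourier integral -/

section GammaInversion

variable {κ θ : ℝ}

theorem re_one_sub_mul_I_mul (θ t : ℝ) : (1 - (θ : ℂ) * Complex.I * (t : ℂ)).re = 1 := by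
  simp

theorem one_sub_mul_I_mul_ne_zero (θ t : ℝ) : 1 - (θ : ℂ) * Complex.I * (t : ℂ) ≠ 0 := by
  intro h
  simpa using congrArg Complex.re h

theorem one_sub_mul_I_mul_mem_slitPlane (θ t : ℝ) :
    1 - (θ : ℂ) * Complex.I * (t : ℂ) ∈ Complex.slitPlane :=
  Or.inl (by rw [re_one_sub_mul_I_mul]; exact one_pos)

theorem norm_one_sub_mul_I_mul (θ t : ℝ) :
    ‖1 - (θ : ℂ) * Complex.I * (t : ℂ)‖ = √(1 + (θ * t) ^ 2) := by
  rw [← Real.sqrt_sq (norm_nonneg _), Complex.sq_norm, Complex.normSq_apply]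
  simp
  ring_nf

theorem norm_one_sub_mul_I_mul_cpow (κ θ t : ℝ) :
    ‖(1 - (θ : ℂ) * Complex.I * (t : ℂ)) ^ (-(κ : ℂ))‖ = (1 + (θ * t) ^ 2) ^ (-κ / 2) := by
  rw [← Complex.ofReal_neg, Complex.norm_cpow_real, norm_one_sub_mul_I_mul,
    Real.rpow_div_two_eq_sqrt _ (by positivity)]

theorem norm_inv_one_sub_mul_I_mul (θ t : ℝ) :
    ‖(1 - (θ : ℂ) * Complex.I * (t : ℂ))⁻¹‖ = (1 + (θ * t) ^ 2) ^ (-1 / 2 : ℝ) := by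
  have h := norm_one_sub_mul_I_mul_cpow 1 θ t
  rwa [Complex.ofReal_one, Complex.cpow_neg_one] at h

theorem continuous_one_sub_mul_I_mul_cpow (κ θ : ℝ) :
    Continuous (fun t : ℝ => (1 - (θ : ℂ) * Complex.I * (t : ℂ)) ^ (-(κ : ℂ))) :=
  Continuous.cpow (by fun_prop) continuous_const (one_sub_mul_I_mul_mem_slitPlane θ)

theorem integrable_rpow_one_add_mul_sq {c s : ℝ} (hc : c ≠ 0) (hs : 1 < s) :
    Integrable (fun t : ℝ => (1 + (c * t) ^ 2) ^ (-s / 2)) := by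
  have h : Integrable (fun t : ℝ => (1 + ‖t‖ ^ 2) ^ (-s / 2)) :=
    integrable_rpow_neg_one_add_norm_sq (by simpa using hs)
  simp_rw [Real.norm_eq_abs, sq_abs] at h
  exact h.comp_mul_left' hc

theorem integrable_one_sub_mul_I_mul_cpow (hκ : 1 < κ) (hθ : θ ≠ 0) :
    Integrable (fun t : ℝ => (1 - (θ : ℂ) * Complex.I * (t : ℂ)) ^ (-(κ : ℂ))) := by
  refine (integrable_rpow_one_add_mul_sq hθ hκ).mono'
    (continuous_one_sub_mul_I_mul_cpow κ θ).aestronglyMeasurable (ae_of_all _ fun t => ?_)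
  rw [norm_one_sub_mul_I_mul_cpow]

theorem norm_exp_neg_I_mul (w t : ℝ) : ‖Complex.exp (-(Complex.I * (w : ℂ) * (t : ℂ)))‖ = 1 := by
  rw [Complex.norm_exp]
  simp

/-- The characteristic function of a Gamma law times `∏ (1 - i θ_l t)⁻¹` is integrable if one of
the `θ_l` does not vanish. -/
theorem integrable_cpow_mul_prod_inv (hκ : 0 < κ) (hθ : θ ≠ 0) {ι : Type*} [Fintype ι]
    {τ : ι → ℝ} {i : ι} (hi : τ i ≠ 0) :
    Integrable (fun t : ℝ => (1 - (θ : ℂ) * Complex.I * (t : ℂ)) ^ (-(κ : ℂ)) *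
      ∏ l, (1 - (τ l : ℂ) * Complex.I * (t : ℂ))⁻¹) := by
  classical
  -- With the smaller of the two scales, a single function `(1 + (c t)²) ^ (-(κ + 1) / 2)` dominates
  -- the Gamma factor times the factor of index `i`; the other factors have norm at most `1`. The
  -- exponent is integrable since `κ + 1 > 1`.
  set c := min |θ| |τ i|
  have hc : 0 < c := lt_min (abs_pos.2 hθ) (abs_pos.2 hi)
  have hmono : ∀ (d s : ℝ), c ≤ |d| → 0 < s → ∀ t : ℝ,
      (1 + (d * t) ^ 2) ^ (-s / 2) ≤ (1 + (c * t) ^ 2) ^ (-s / 2) := by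
    intro d s hd hs t
    refine Real.rpow_le_rpow_of_nonpos (by positivity) ?_ (by linarith)
    rw [mul_pow, mul_pow, ← sq_abs d]
    gcongr
  have hle1 : ∀ l (t : ℝ), ‖(1 - (τ l : ℂ) * Complex.I * (t : ℂ))⁻¹‖ ≤ 1 := by
    intro l t
    rw [norm_inv_one_sub_mul_I_mul]
    exact Real.rpow_le_one_of_one_le_of_nonpos (by nlinarith [sq_nonneg (τ l * t)]) (by norm_num)
  refine (integrable_rpow_one_add_mul_sq hc.ne' (s := κ + 1) (by linarith)).mono' ?_
    (ae_of_all _ fun t => ?_)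
  · refine Continuous.aestronglyMeasurable ((continuous_one_sub_mul_I_mul_cpow κ θ).mul ?_)
    exact continuous_finsetProd _ fun l _ =>
      Continuous.inv₀ (by fun_prop) (one_sub_mul_I_mul_ne_zero (τ l))
  · rw [norm_mul, norm_prod, norm_one_sub_mul_I_mul_cpow,
      ← Finset.mul_prod_erase _ _ (Finset.mem_univ i)]
    have h1 := hmono θ κ (min_le_left _ _) hκ t
    have h2 := hmono (τ i) 1 (min_le_right _ _) one_pos t
    have h3 : ∏ l ∈ Finset.univ.erase i, ‖(1 - (τ l : ℂ) * Complex.I * (t : ℂ))⁻¹‖ ≤ 1 :=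
      Finset.prod_le_one (fun _ _ => norm_nonneg _) fun l _ => hle1 l t
    rw [norm_inv_one_sub_mul_I_mul,
      show -(κ + 1) / 2 = -κ / 2 + -1 / 2 by ring, Real.rpow_add (by positivity)]
    gcongr
    exact (mul_le_of_le_one_right (by positivity) h3).trans h2

theorem continuousAt_gammaPDFReal {r w : ℝ} (hw : w ≠ 0) :
    ContinuousAt (gammaPDFReal κ r) w := by
  rcases lt_or_gt_of_ne hw with h | h
  · refine (continuousAt_const (y := (0 : ℝ))).congr ?_
    filter_upwards [Iio_mem_nhds h] with x hx
    rw [gammaPDFReal, if_neg (not_le.2 hx)]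
  · have hc : ContinuousAt
        (fun x => r ^ κ / Real.Gamma κ * x ^ (κ - 1) * Real.exp (-(r * x))) w :=
      ((continuousAt_const.mul (Real.continuousAt_rpow_const _ _ (Or.inl hw))).mul
        (by fun_prop))
    refine hc.congr ?_
    filter_upwards [Ioi_mem_nhds h] with x hx
    rw [gammaPDFReal, if_pos (le_of_lt hx)]

theorem integral_cpow_mul_exp_eq_gammaPDFReal (hκ : 1 < κ) (hθ : 0 < θ) {w : ℝ} (hw : w ≠ 0) :
    ∫ t : ℝ, (1 - (θ : ℂ) * Complex.I * (t : ℂ)) ^ (-(κ : ℂ)) *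
      Complex.exp (-(Complex.I * (w : ℂ) * (t : ℂ))) =
      2 * Real.pi * (gammaPDFReal κ θ⁻¹ w : ℂ) := by
  have hκ0 : 0 < κ := by linarith
  have hr := inv_pos.2 hθ
  refine integral_mul_exp_of_continuousAt (f := fun x => (gammaPDFReal κ θ⁻¹ x : ℂ))
    (integrable_gammaPDFReal hκ0 hr).ofReal (fun t => ?_)
    (integrable_one_sub_mul_I_mul_cpow hκ hθ.ne')
    (Complex.continuous_ofReal.continuousAt.comp (continuousAt_gammaPDFReal hw))
  rw [← charFun_gammaLaw hκ0 hθ, gammaLaw, charFun_apply_real, integral_gammaMeasure hκ0 hr]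
  refine integral_congr_ae (ae_of_all _ fun x => ?_)
  simp only [Complex.real_smul]
  rw [mul_comm]

theorem tendsto_cpow_mul_exp_zero (hκ : 0 < κ) (hθ : θ ≠ 0) (w : ℝ) {l : Filter ℝ}
    (hl : Tendsto (fun t : ℝ => |t|) l atTop) :
    Tendsto (fun t : ℝ => (1 - (θ : ℂ) * Complex.I * (t : ℂ)) ^ (-(κ : ℂ)) *
      Complex.exp (-(Complex.I * (w : ℂ) * (t : ℂ)))) l (𝓝 0) := by
  rw [tendsto_zero_iff_norm_tendsto_zero]
  simp_rw [norm_mul, norm_exp_neg_I_mul, mul_one, norm_one_sub_mul_I_mul_cpow]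
  have h1 : Tendsto (fun t : ℝ => 1 + (θ * t) ^ 2) l atTop := by
    refine tendsto_atTop_add_const_left _ _ ?_
    have h2 : Tendsto (fun t : ℝ => θ ^ 2 * |t| ^ 2) l atTop :=
      ((tendsto_pow_atTop two_ne_zero).comp hl).const_mul_atTop (by positivity)
    refine h2.congr fun t => ?_
    rw [sq_abs, mul_pow]
  simp_rw [neg_div]
  exact (tendsto_rpow_neg_atTop (half_pos hκ)).comp h1

/-- Differentiating the power raises the shape by one, while differentiating the exponential
reproduces the function times `-i w`. This is the integration by parts that relates shape `κ` to
shape `κ + 1`. -/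
theorem hasDerivAt_cpow_mul_exp (κ θ w t : ℝ) :
    HasDerivAt (fun t : ℝ => (1 - (θ : ℂ) * Complex.I * (t : ℂ)) ^ (-(κ : ℂ)) *
      Complex.exp (-(Complex.I * (w : ℂ) * (t : ℂ))))
      (κ * θ * Complex.I * ((1 - (θ : ℂ) * Complex.I * (t : ℂ)) ^ (-((κ + 1 : ℝ) : ℂ)) *
        Complex.exp (-(Complex.I * (w : ℂ) * (t : ℂ)))) -
      Complex.I * w * ((1 - (θ : ℂ) * Complex.I * (t : ℂ)) ^ (-(κ : ℂ)) *
        Complex.exp (-(Complex.I * (w : ℂ) * (t : ℂ))))) t := by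
  have hid : HasDerivAt (fun t : ℝ => (t : ℂ)) 1 t := Complex.ofRealCLM.hasDerivAt
  have h1 : HasDerivAt (fun t : ℝ => 1 - (θ : ℂ) * Complex.I * (t : ℂ))
      (-((θ : ℂ) * Complex.I)) t := by
    simpa using (hid.const_mul ((θ : ℂ) * Complex.I)).const_sub 1
  have h2 : HasDerivAt (fun z : ℂ => z ^ (-(κ : ℂ)))
      (-(κ : ℂ) * (1 - (θ : ℂ) * Complex.I * (t : ℂ)) ^ (-(κ : ℂ) - 1))
      (1 - (θ : ℂ) * Complex.I * (t : ℂ)) :=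
    ((hasDerivAt_id _).cpow_const (one_sub_mul_I_mul_mem_slitPlane θ t)).congr_deriv (by simp)
  have h3 : HasDerivAt (fun t : ℝ => Complex.exp (-(Complex.I * (w : ℂ) * (t : ℂ))))
      (Complex.exp (-(Complex.I * (w : ℂ) * (t : ℂ))) * -(Complex.I * w)) t := by
    have := ((hid.const_mul (Complex.I * (w : ℂ))).neg).cexp
    simpa using this
  refine ((h2.comp t h1).mul h3).congr_deriv ?_
  simp only [Function.comp_apply]
  rw [show (-((κ + 1 : ℝ) : ℂ)) = -(κ : ℂ) - 1 by push_cast; ring]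
  ring

/-- The characteristic function of a Gamma law need not be integrable, but its improper Fourier
integral recovers the density away from the origin. -/
theorem tendsto_intervalIntegral_cpow_mul_exp (hκ : 0 < κ) (hθ : 0 < θ) {w : ℝ} (hw : w ≠ 0) :
    Tendsto (fun T : ℝ => ∫ t in (-T)..T, (1 - (θ : ℂ) * Complex.I * (t : ℂ)) ^ (-(κ : ℂ)) *
      Complex.exp (-(Complex.I * (w : ℂ) * (t : ℂ)))) atTop
      (𝓝 (2 * Real.pi * (gammaPDFReal κ θ⁻¹ w : ℂ))) := by
  set u : ℝ → ℝ → ℂ := fun κ t => (1 - (θ : ℂ) * Complex.I * (t : ℂ)) ^ (-(κ : ℂ)) *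
      Complex.exp (-(Complex.I * (w : ℂ) * (t : ℂ))) with hu
  have hcont : ∀ κ, Continuous (u κ) := fun κ =>
    (continuous_one_sub_mul_I_mul_cpow κ θ).mul (by fun_prop)
  have hw' : (w : ℂ) ≠ 0 := Complex.ofReal_ne_zero.2 hw
  -- Solving for the integral of shape `κ` requires division by `i w`, hence `w ≠ 0`. What remains
  -- is an absolutely convergent integral of shape `κ + 1` and boundary terms that tend to `0`.
  have hparts : ∀ T : ℝ, ∫ t in (-T)..T, u κ t =
      (κ * θ * Complex.I * (∫ t in (-T)..T, u (κ + 1) t) - (u κ T - u κ (-T))) /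
        (Complex.I * w) := by
    intro T
    have h := intervalIntegral.integral_eq_sub_of_hasDerivAt (a := -T) (b := T)
      (fun t _ => hasDerivAt_cpow_mul_exp κ θ w t)
      (Continuous.intervalIntegrable (((hcont (κ + 1)).const_mul (κ * θ * Complex.I : ℂ)).sub
        ((hcont κ).const_mul (Complex.I * w))) _ _)
    rw [intervalIntegral.integral_sub
      (((hcont (κ + 1)).const_mul (κ * θ * Complex.I : ℂ)).intervalIntegrable _ _)
      (((hcont κ).const_mul (Complex.I * w)).intervalIntegrable _ _),
      intervalIntegral.integral_const_mul, intervalIntegral.integral_const_mul] at h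
    rw [eq_div_iff (mul_ne_zero Complex.I_ne_zero hw')]
    simp only [hu] at h ⊢
    linear_combination -h
  have hint : Integrable (u (κ + 1)) :=
    (integrable_one_sub_mul_I_mul_cpow (κ := κ + 1) (by linarith) hθ.ne').mul_bdd (c := 1)
      (by fun_prop) (ae_of_all _ fun t => (norm_exp_neg_I_mul w t).le)
  have hlim := intervalIntegral_tendsto_integral hint tendsto_neg_atTop_atBot tendsto_id
  have htop : Tendsto (fun T => u κ T) atTop (𝓝 0) :=
    tendsto_cpow_mul_exp_zero hκ hθ.ne' w tendsto_abs_atTop_atTop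
  have hbot : Tendsto (fun T => u κ (-T)) atTop (𝓝 0) :=
    (tendsto_cpow_mul_exp_zero hκ hθ.ne' w tendsto_abs_atBot_atTop).comp
      tendsto_neg_atTop_atBot
  have hval : ∫ t, u (κ + 1) t = 2 * Real.pi * (gammaPDFReal (κ + 1) θ⁻¹ w : ℂ) :=
    integral_cpow_mul_exp_eq_gammaPDFReal (by linarith) hθ hw
  have hpdf := gammaPDFReal_mul_pow hκ (inv_pos.2 hθ) 1 hw
  have hΓ := (Real.Gamma_pos_of_pos hκ).ne'
  rw [Nat.cast_one, Real.Gamma_add_one hκ.ne', pow_one, pow_one] at hpdf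
  -- The densities of shapes `κ` and `κ + 1` satisfy the same recursion as the limits of the
  -- integrals.
  have hpdf' : (gammaPDFReal κ θ⁻¹ w : ℂ) = κ * θ * gammaPDFReal (κ + 1) θ⁻¹ w / w := by
    rw [eq_div_iff hw', ← Complex.ofReal_mul, hpdf]
    push_cast
    have : (Real.Gamma κ : ℂ) ≠ 0 := Complex.ofReal_ne_zero.2 hΓ
    field_simp
  refine Tendsto.congr (fun T => (hparts T).symm) ?_
  have hfin := ((hlim.const_mul (κ * θ * Complex.I : ℂ)).sub (htop.sub hbot)).div_const
    (Complex.I * w)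
  rw [hval, sub_zero, sub_zero] at hfin
  have heq : 2 * Real.pi * (gammaPDFReal κ θ⁻¹ w : ℂ) = κ * θ * Complex.I *
      (2 * Real.pi * (gammaPDFReal (κ + 1) θ⁻¹ w : ℂ)) / (Complex.I * w) := by
    rw [hpdf']
    have := Complex.I_ne_zero
    field_simp
  rw [heq]
  exact hfin

end GammaInversion

namespace Network

variable {M K L : ℕ} (N : Network M K L)

/-! ### The rate event -/

section RateEvent

variable {S : Finset (Fin K)} {hHat : Fin K → EuclideanSpace ℂ (Fin M)}
  {hHat0 : Fin L → EuclideanSpace ℂ (Fin M)}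

theorem reverseInterference_nonneg (h : Fin L → ℂ) : 0 ≤ N.reverseInterference h :=
  Finset.sum_nonneg fun _ _ => mul_nonneg N.Pp_pos.le (by positivity)

/-- For nonnegative interferences, the rate reaches `y` exactly when
`Z + (1 - C_y) I ≤ ζ_y`. -/
theorem le_modelRate_iff (hG : LinearIndependent ℂ (channels S hHat hHat0)) (k : S) {y I Z : ℝ}
    (hy : 0 < y) (hI : 0 ≤ I) (hZ : 0 ≤ Z) :
    y ≤ N.modelRate S hHat hHat0 k I Z ↔ Z + (1 - N.C k y) * I ≤ N.zeta k y := by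
  have hβ := N.β_pos k
  have hδ := N.σδ2_pos
  have hσ := N.σw2_pos
  have hε := N.ε2_nonneg
  have hd := dim_pos hG
  have h2y := two_rpow_sub_one_pos hy
  have h2R := two_rpow_sub_one_pos (N.R0_pos k)
  have hden : 0 < N.σw2 + I + Z := by positivity
  -- The dimension factor `M - |S| - L + 1` cancels between the two average gains, leaving `β_k /
  -- (β_k + σ_δ²)`.
  have hrate : N.modelRate S hHat hHat0 k I Z = Real.logb 2 (1 +
      N.C k y * ((2 : ℝ) ^ y - 1) * (N.σw2 + I + N.ε2) / (N.σw2 + I + Z)) := by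
    rw [modelRate, rate, power, averageGain_eq hG k hβ, averageGain_eq hG k (add_pos hβ hδ), C]
    congr 2
    have hd' : (M : ℝ) - (S.card : ℝ) - (L : ℝ) + 1 ≠ 0 := hd.ne'
    field_simp
  have hC : 0 < N.C k y := by
    rw [C]
    positivity
  rw [hrate, Real.le_logb_iff_rpow_le one_lt_two (by positivity), ← sub_le_iff_le_add',
    le_div_iff₀ hden, show N.C k y * ((2 : ℝ) ^ y - 1) * (N.σw2 + I + N.ε2) =
      ((2 : ℝ) ^ y - 1) * (N.C k y * (N.σw2 + I + N.ε2)) by ring, mul_le_mul_iff_right₀ h2y, zeta]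
  constructor <;> intro h <;> linarith

end RateEvent

/-! ### Characteristic function of the scaled reverse interference. -/

section Law

variable {Ω : Type*} [MeasurableSpace Ω] {P : Measure Ω}
  {h : Fin L → Ω → ℂ} {k : Fin K}

/-- The scalar `a` stands for `1 - C_y`, which may be negative, so the scaled terms need not be
Gamma variables. Rescaling the argument of the exponential characteristic function works for every
sign. -/
theorem charFun_map_mul_reverseInterference
    (h_law : ∀ l, HasLaw (h l) (complexGaussian (N.βr l k)) P) (h_indep : iIndepFun h P)
    (a t : ℝ) :
    charFun (P.map fun ω => a * N.reverseInterference fun l => h l ω) t =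
      ∏ l, (1 - ((a * N.Pp * N.βr l k : ℝ) : ℂ) * Complex.I * (t : ℂ))⁻¹ := by
  have hsum : (fun ω => a * N.reverseInterference fun l => h l ω) =
      fun ω => ∑ l, a * N.Pp * ‖h l ω‖ ^ 2 := by
    funext ω
    rw [reverseInterference, Finset.mul_sum]
    simp_rw [mul_assoc]
  have hm : ∀ _ : Fin L, Measurable fun z : ℂ => a * N.Pp * ‖z‖ ^ 2 := fun _ =>
    (measurable_norm.pow_const 2).const_mul _
  have hind : iIndepFun (fun l ω => a * N.Pp * ‖h l ω‖ ^ 2) P := h_indep.comp _ hm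
  have hmeas : ∀ l, AEMeasurable (fun ω => a * N.Pp * ‖h l ω‖ ^ 2) P := fun l =>
    (hm l).comp_aemeasurable (h_law l).aemeasurable
  rw [hsum, hind.charFun_map_fun_sum_eq_prod hmeas, Finset.prod_apply]
  refine Finset.prod_congr rfl fun l _ => ?_
  have hmap : P.map (fun ω => a * N.Pp * ‖h l ω‖ ^ 2) =
      (gammaLaw 1 (N.βr l k)).map (fun x => a * N.Pp * x) := by
    rw [← map_norm_sq_complexGaussian_eq_gammaLaw (N.βr_pos l k), ← (h_law l).map_eq,
      AEMeasurable.map_map_of_aemeasurable (by fun_prop) (h_law l).aemeasurable,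
      AEMeasurable.map_map_of_aemeasurable (by fun_prop)
        ((by fun_prop : Measurable fun z : ℂ => ‖z‖ ^ 2).comp_aemeasurable (h_law l).aemeasurable)]
    rfl
  rw [hmap, charFun_map_mul, charFun_gammaLaw one_pos (N.βr_pos l k), Complex.ofReal_one,
    Complex.cpow_neg_one]
  push_cast
  ring_nf

end Law

end Network

/-! ### Absolute continuity, support and masses of the Gamma law. -/

theorem gammaLaw_absolutelyContinuous (κ θ : ℝ) : gammaLaw κ θ ≪ volume :=
  withDensity_absolutelyContinuous _ _

theorem ae_nonneg_gammaLaw (κ θ : ℝ) : ∀ᵐ x ∂(gammaLaw κ θ), 0 ≤ x := by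
  rw [gammaLaw, gammaMeasure, ae_withDensity_iff (measurable_gammaPDF _ _)]
  refine ae_of_all _ fun x hx => ?_
  by_contra h
  exact hx (gammaPDF_of_neg (not_le.1 h))

theorem measureReal_gammaLaw {κ θ : ℝ} (hκ : 0 < κ) (hθ : 0 < θ) {s : Set ℝ}
    (hs : MeasurableSet s) : (gammaLaw κ θ).real s = ∫ x in s, gammaPDFReal κ θ⁻¹ x := by
  have := isProbabilityMeasure_gammaLaw hκ hθ
  rw [← integral_indicator_one hs, gammaLaw, integral_gammaMeasure hκ (inv_pos.2 hθ),
    ← integral_indicator hs]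
  congr 1
  funext x
  by_cases hx : x ∈ s <;> simp [hx]

end UnderlayCRN

/-! ### The distribution of the approximate rate. -/

theorem theorem2 {M K L : ℕ} (hL : 0 < L) (N : UnderlayCRN.Network M K L)
    (S : Finset (Fin K)) (hS : 2 ≤ S.card) (k : S)
    -- a realization of the channel estimates for which the zero-forcing vectors are defined
    (hHat : Fin K → EuclideanSpace ℂ (Fin M)) (hHat0 : Fin L → EuclideanSpace ℂ (Fin M))
    (hG : LinearIndependent ℂ (UnderlayCRN.channels S hHat hHat0))
    -- the channels from the primary transmitters to SU-`k`, and the inter-SU interference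
    {Ω : Type*} [MeasurableSpace Ω] (P : Measure Ω) [IsProbabilityMeasure P]
    (h : Fin L → Ω → ℂ) (Z : Ω → ℝ)
    (h_law : ∀ l, HasLaw (h l) (UnderlayCRN.complexGaussian (N.βr l k)) P)
    (Z_law : HasLaw Z (N.interSULaw S hHat hHat0 k) P)
    (h_indep : iIndepFun h P)
    (Z_indep : IndepFun (fun ω l => h l ω) Z P)
    (y : ℝ) (hy : 0 < y) :
    ∃ p : ℝ → ℂ,
      -- the inner integral: an improper integral for `w ≠ 0`, absolutely convergent if `C_y ≠ 1`
      (∀ w : ℝ, w ≠ 0 →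
        Tendsto (fun T : ℝ => ∫ t in (-T)..T, N.integrand S k y w t) atTop (𝓝 (p w))) ∧
      (N.C k y ≠ 1 → ∀ w : ℝ, Integrable (fun t : ℝ => N.integrand S k y w t) ∧
        p w = ∫ t : ℝ, N.integrand S k y w t) ∧
      -- the outer integral
      IntegrableOn p (Set.Iic (N.zeta k y)) ∧
      ((P.real {ω | y ≤ N.modelRate S hHat hHat0 k
          (N.reverseInterference (fun l => h l ω)) (Z ω)} : ℝ) : ℂ) =
        1 / (2 * (Real.pi : ℂ)) * ∫ w in Set.Iic (N.zeta k y), p w := by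
  have hκ := UnderlayCRN.Network.kappaZ_pos (N := N) hL hS hG k
  have hθ := UnderlayCRN.Network.thetaZ_pos (N := N) hL hS hG k
  rw [UnderlayCRN.Network.interSULaw_eq hL hS hG k] at Z_law
  set κ := N.kappaZ S k with hκ_def
  set θ := N.thetaZ S k with hθ_def
  set c := N.C k y with hc_def
  set X : Ω → ℝ := fun ω => (1 - c) * N.reverseInterference fun l => h l ω with hX_def
  have hZ0 : ∀ᵐ ω ∂P, 0 ≤ Z ω := by
    have h1 := UnderlayCRN.ae_nonneg_gammaLaw κ θ
    rw [← Z_law.map_eq] at h1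
    exact ae_of_ae_map Z_law.aemeasurable h1
  have hevent : P.real {ω | y ≤ N.modelRate S hHat hHat0 k
      (N.reverseInterference (fun l => h l ω)) (Z ω)} =
      P.real {ω | X ω + Z ω ≤ N.zeta k y} := by
    refine measureReal_congr ?_
    filter_upwards [hZ0] with ω hω
    refine propext ?_
    have := N.le_modelRate_iff hG k hy (N.reverseInterference_nonneg fun l => h l ω) hω
    rw [add_comm] at this
    exact this
  have hXm : AEMeasurable X P :=
    (N.measurable_reverseInterference.const_mul (1 - c)).comp_aemeasurable
      (aemeasurable_pi_lambda _ fun l => (h_law l).aemeasurable)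
  have hXZm : AEMeasurable (fun ω => X ω + Z ω) P := hXm.add Z_law.aemeasurable
  -- For `c = 1` the reverse interference drops out of the event and the product is `1`: the law is
  -- a pure Gamma law, whose characteristic function may fail to be integrable.
  by_cases hc : c = 1
  · have hint : ∀ w t, N.integrand S k y w t =
        (1 - (θ : ℂ) * Complex.I * (t : ℂ)) ^ (-(κ : ℂ)) *
          Complex.exp (-(Complex.I * (w : ℂ) * (t : ℂ))) := by
      intro w t
      rw [UnderlayCRN.Network.integrand]
      simp [UnderlayCRN.Network.thetaLK, ← hc_def, hc, ← hκ_def, ← hθ_def]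
    -- The improper integral identifies this witness for `w ≠ 0`; its value at the null point `w =
    -- 0` does not affect the outer integral.
    refine ⟨fun w => 2 * Real.pi * (gammaPDFReal κ θ⁻¹ w : ℂ), ?_, fun hne => absurd hc hne, ?_, ?_⟩
    · intro w hw
      simp_rw [hint]
      exact UnderlayCRN.tendsto_intervalIntegral_cpow_mul_exp hκ hθ hw
    · exact ((UnderlayCRN.integrable_gammaPDFReal hκ (inv_pos.2 hθ)).ofReal.const_mul
        _).integrableOn
    · have hset : {ω | X ω + Z ω ≤ N.zeta k y} = {ω | Z ω ≤ N.zeta k y} := by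
        ext ω
        simp [hX_def, hc]
      rw [hevent, hset, Z_law.measureReal_eq (p := fun x => x ≤ N.zeta k y) measurableSet_Iic]
      change (((UnderlayCRN.gammaLaw κ θ).real (Set.Iic (N.zeta k y)) : ℝ) : ℂ) = _
      rw [UnderlayCRN.measureReal_gammaLaw hκ hθ measurableSet_Iic, integral_const_mul,
        integral_complex_ofReal]
      have : (Real.pi : ℂ) ≠ 0 := Complex.ofReal_ne_zero.2 Real.pi_ne_zero
      field_simp
  · set μ := P.map (fun ω => X ω + Z ω) with hμ_def
    have : IsProbabilityMeasure μ := Measure.isProbabilityMeasure_map hXZm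
    have hXZ : IndepFun X Z P := Z_indep.comp
      (N.measurable_reverseInterference.const_mul (1 - c)) measurable_id
    have hchar : ∀ t : ℝ, charFun μ t =
        (1 - (θ : ℂ) * Complex.I * (t : ℂ)) ^ (-(κ : ℂ)) *
          ∏ l, (1 - (N.thetaLK l k y : ℂ) * Complex.I * (t : ℂ))⁻¹ := by
      intro t
      rw [hμ_def, hXZ.charFun_map_fun_add_eq_mul hXm Z_law.aemeasurable, Pi.mul_apply,
        N.charFun_map_mul_reverseInterference h_law h_indep, Z_law.map_eq,
        UnderlayCRN.charFun_gammaLaw hκ hθ, mul_comm]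
      rfl
    -- Convolving any law with the absolutely continuous Gamma law of `Z` gives an absolutely
    -- continuous law, so nothing is needed about the law of `X`.
    have hμ_ac : μ ≪ volume := by
      have hconv : μ = (P.map X).conv (P.map Z) :=
        hXZ.map_add_eq_map_conv_map₀ hXm Z_law.aemeasurable
      rw [hconv, Z_law.map_eq]
      have := UnderlayCRN.isProbabilityMeasure_gammaLaw hκ hθ
      exact Measure.conv_absolutelyContinuous (UnderlayCRN.gammaLaw_absolutelyContinuous κ θ)
    -- Since `L ≥ 1`, one exponential factor exists, and `c ≠ 1` keeps its scale away from `0`; it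
    -- supplies the decay missing for integrability.
    have hθl : N.thetaLK ⟨0, hL⟩ k y ≠ 0 :=
      mul_ne_zero (mul_ne_zero (sub_ne_zero.2 (Ne.symm hc)) N.Pp_pos.ne') (N.βr_pos _ _).ne'
    have hchar_int : Integrable (charFun μ) := by
      rw [funext hchar]
      exact UnderlayCRN.integrable_cpow_mul_prod_inv hκ hθ.ne' hθl
    have hint : ∀ w t, N.integrand S k y w t =
        charFun μ t * Complex.exp (-(Complex.I * (w : ℂ) * (t : ℂ))) := by
      intro w t
      rw [hchar]
      rfl
    have hIntegrable : ∀ w, Integrable fun t => N.integrand S k y w t := by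
      intro w
      simp_rw [hint]
      exact hchar_int.mul_bdd (c := 1) (by fun_prop)
        (ae_of_all _ fun t => (UnderlayCRN.norm_exp_neg_I_mul w t).le)
    obtain ⟨h1, h2⟩ :=
      UnderlayCRN.measureReal_eq_integral_of_integrable_charFun hμ_ac hchar_int
    simp_rw [← hint] at h1 h2
    refine ⟨fun w => ∫ t, N.integrand S k y w t, fun w _ => ?_, fun _ w => ⟨hIntegrable w, rfl⟩,
      h1.integrableOn, ?_⟩
    · exact intervalIntegral_tendsto_integral (hIntegrable w) tendsto_neg_atTop_atBot tendsto_id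
    · rw [hevent, ← h2 _ measurableSet_Iic, measureReal_def, measureReal_def, hμ_def,
        Measure.map_apply_of_aemeasurable hXZm measurableSet_Iic]
      rfl
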